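/- Let $0\le m<1$ and let $f:(0,\infty)\to[0,\infty)$ be continuous. Let $F=\{F(\varphi)\}$, $\varphi\in C_c^\infty(\mathbb R\times\mathbb R^2)$, be a centred Gaussian process on a probability space with covariance $$E[F(\varphi)F(\psi)]=\int_0^\infty\!\int_{\mathbb R^2}\!\int_{\mathbb R^2}\varphi(s,x)\,f(\|x-y\|)\,\psi(s,y)\,dy\,dx\,ds .$$ For a deterministic measurable $g$ on $\mathbb R\times\mathbb R^2$, the stochastic integral $\int g\,dF$ denotes the $L^2$-limit of $F(\varphi_n)$ for test functions $\varphi_n$ converging to $g$ in the norm $$\|h\|_+^2=\int_0^\infty\!\int_{\mathbb R^2}\!\int_{\mathbb R^2}|h(s,y)|\,|h(s,z)|\,f(\|y-z\|)\,dz\,dy\,ds .$$ Let $$G(t,x,m)=\frac{1_{\{t-(\rho(x)-\frac{m x_1}{1-m^2})\ge 0\}}}{2\pi\sqrt{1-m^2}\,\sqrt{\left(t+\frac{m x_1}{1-m^2}\right)^2-\rho^2(x)}},\qquad \rho(x)=\sqrt{\frac{x_1^2}{(1-m^2)^2}+\frac{x_2^2}{1-m^2}},$$ be the Green function of the convected wave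 operator $(\partial_t+m\,\partial_{x_1})^2-\Delta$ on $\mathbb R^2$, and let $$X(t,x)=\int_{(0,t]\times\mathbb R^2}G(t-s,x-y,m)\,dF(s,y),\qquad t\ge 0,\ x\in\mathbb R^2,$$ be the solution process of $(\partial_t+m\,\partial_{x_1})^2u-\Delta u=\dot F$ with zero initial data. Assume that there is $0<\alpha<1$ such that $\int_{0^+}f(r)\,r^{1-\alpha}\,dr<\infty$. Then these stochastic integrals exist for all $(t,x)\in[0,\infty)\times\mathbb R^2$, and the process $X$ has a modification all of whose sample paths $(t,x)\mapsto X(t,x)$ are Hölder continuous of every order $b\in(0,\alpha/4)$ on every compact subset of $[0,\infty)\times\mathbb R^2$. -/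

import Mathlib

open MeasureTheory ProbabilityTheory Filter Topology Set
open scoped NNReal ENNReal Distributions

noncomputable section

/-- The Euclidean plane. -/
abbrev Plane : Type := EuclideanSpace ℝ (Fin 2)

/-- Real-valued smooth compactly supported functions of `(s, y) ∈ ℝ × ℝ² = ℝ³`. -/
abbrev TestFn : Type := 𝓓((⊤ : TopologicalSpace.Opens (ℝ × Plane)), ℝ)

/-- `ρ(x) = √(x₁² / (1 - m²)² + x₂² / (1 - m²))`. -/
def machRho (m : ℝ) (x : Plane) : ℝ :=
  Real.sqrt (x 0 ^ 2 / (1 - m ^ 2) ^ 2 + x 1 ^ 2 / (1 - m ^ 2))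

/-- The Green function of `(∂ₜ + m ∂₁)² - Δ` in two space dimensions. (On the boundary of the
cone, which is a null set, the denominator and hence the value in Lean is `0`.) -/
def greenFn (m t : ℝ) (x : Plane) : ℝ :=
  open Classical in
  if 0 ≤ t - (machRho m x - m * x 0 / (1 - m ^ 2)) then
    1 / (2 * Real.pi * Real.sqrt (1 - m ^ 2) *
      Real.sqrt ((t + m * x 0 / (1 - m ^ 2)) ^ 2 - machRho m x ^ 2))
  else 0

/-- `F` is a centred Gaussian noise, white in time and with spatial covariance `f(‖x - y‖)`:
a centred Gaussian process indexed by the test functions on `ℝ³`, with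
`E[F(φ) F(ψ)] = ∫_{s > 0} ∫ ∫ φ(s, x) f(‖x - y‖) ψ(s, y) dy dx ds`. -/
structure IsSpatialGaussianNoise {Ω : Type*} [MeasurableSpace Ω] (P : Measure Ω)
    (f : ℝ → ℝ) (F : TestFn → Ω → ℝ) : Prop where
  gaussian : IsGaussianProcess F P
  centred : ∀ φ : TestFn, ∫ ω, F φ ω ∂P = 0
  covariance : ∀ φ ψ : TestFn, ∫ ω, F φ ω * F ψ ω ∂P =
    ∫ s in Ioi (0 : ℝ), ∫ x : Plane, ∫ y : Plane, φ (s, x) * f ‖x - y‖ * ψ (s, y)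

/-- The square of the norm on deterministic integrands given by the dominating measure
`f(‖y - z‖) dy dz ds` of the noise:
`∫_{s > 0} ∫ ∫ |g(s, y)| |g(s, z)| f(‖y - z‖) dz dy ds ∈ [0, ∞]`. -/
def walshNormSq (f : ℝ → ℝ) (g : ℝ × Plane → ℝ) : ℝ≥0∞ :=
  ∫⁻ s in Ioi (0 : ℝ), ∫⁻ y : Plane, ∫⁻ z : Plane,
    ‖g (s, y)‖ₑ * ‖g (s, z)‖ₑ * ENNReal.ofReal (f ‖y - z‖)

/-- `Y` is (a version of) the stochastic integral `∫ g dF` of the deterministic function `g`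
over `(0, ∞) × ℝ²`: the integral is the continuous extension of `φ ↦ F(φ) ∈ L²(P)` from test
functions to their closure in the norm of `walshNormSq`. -/
structure IsStochIntegral {Ω : Type*} [MeasurableSpace Ω] (P : Measure Ω)
    (f : ℝ → ℝ) (F : TestFn → Ω → ℝ) (g : ℝ × Plane → ℝ) (Y : Ω → ℝ) : Prop where
  measurable_integrand : Measurable g
  memLp : MemLp Y 2 P
  exists_approx : ∃ φ : ℕ → TestFn,
    Tendsto (fun n => walshNormSq f (fun p => φ n p - g p)) atTop (𝓝 0) ∧
    Tendsto (fun n => eLpNorm (fun ω => F (φ n) ω - Y ω) 2 P) atTop (𝓝 0)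

/-- The integrand `(s, y) ↦ 1_{(0, t]}(s) G(t - s, x - y, m)`. -/
def greenIntegrand (m : ℝ) (t : ℝ≥0) (x : Plane) (p : ℝ × Plane) : ℝ :=
  (Ioc (0 : ℝ) t).indicator (fun s => greenFn m (t - s) (x - p.2)) p.1

/-- `X(t, x) = ∫_{(0, t] × ℝ²} G(t - s, x - y, m) dF(s, y)` almost surely, for every `t ≥ 0` and
`x ∈ ℝ²`: `X` is (a version of) the mild solution of the convected wave equation
`(∂ₜ + m ∂₁)² u - Δu = Ḟ` with zero initial conditions. -/
def IsMildSolution {Ω : Type*} [MeasurableSpace Ω] (P : Measure Ω)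
    (m : ℝ) (f : ℝ → ℝ) (F : TestFn → Ω → ℝ) (X : ℝ≥0 → Plane → Ω → ℝ) : Prop :=
  ∀ t x, IsStochIntegral P f F (greenIntegrand m t x) (X t x)

end

/-- The dominating measure `f(‖y - z‖) dz dy ds` of the noise on `(0, ∞) × ℝ² × ℝ²`. -/
noncomputable def noiseMeasure (f : ℝ → ℝ) : Measure (ℝ × Plane × Plane) :=
  ((volume.restrict (Ioi 0)).prod (volume.prod volume)).withDensity
    (fun q => ENNReal.ofReal (f ‖q.2.1 - q.2.2‖))

/-- A measurable nonnegative radial profile that is locally integrable on the plane. -/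
structure IsNoiseKernel (f : ℝ → ℝ) : Prop where
  measurable : Measurable f
  nonneg : ∀ r, 0 ≤ f r
  lintegral_ball_lt_top :
    ∀ R : ℝ, ∫⁻ w in Metric.closedBall (0 : Plane) R, ENNReal.ofReal (f ‖w‖) < ∞

section NoiseMeasure

variable {f : ℝ → ℝ}

lemma measurable_kernel (hf : Measurable f) :
    Measurable (fun q : ℝ × Plane × Plane => ENNReal.ofReal (f ‖q.2.1 - q.2.2‖)) :=
  (hf.comp (by fun_prop)).ennreal_ofReal

lemma lintegral_noiseMeasure (hf : Measurable f) {h : ℝ × Plane × Plane → ℝ≥0∞}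
    (hh : Measurable h) :
    ∫⁻ q, h q ∂noiseMeasure f =
      ∫⁻ s in Ioi (0 : ℝ), ∫⁻ y : Plane, ∫⁻ z : Plane,
        h (s, y, z) * ENNReal.ofReal (f ‖y - z‖) := by
  have hk := measurable_kernel hf
  rw [noiseMeasure, lintegral_withDensity_eq_lintegral_mul _ hk hh,
    lintegral_prod _ (hk.mul hh).aemeasurable]
  refine lintegral_congr fun s => ?_
  refine (lintegral_prod (fun p : Plane × Plane =>
    ((fun q : ℝ × Plane × Plane => ENNReal.ofReal (f ‖q.2.1 - q.2.2‖)) * h) (s, p))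
    ((hk.mul hh).comp measurable_prodMk_left).aemeasurable).trans ?_
  simp only [Pi.mul_apply, mul_comm]

lemma walshNormSq_eq_lintegral (hf : Measurable f) {g : ℝ × Plane → ℝ} (hg : Measurable g) :
    walshNormSq f g =
      ∫⁻ q, ‖g (q.1, q.2.1)‖ₑ * ‖g (q.1, q.2.2)‖ₑ ∂noiseMeasure f := by
  rw [lintegral_noiseMeasure hf (by fun_prop)]
  rfl

lemma noiseMeasure_absolutelyContinuous :
    noiseMeasure f ≪ (volume.restrict (Ioi 0)).prod (volume.prod volume) :=
  withDensity_absolutelyContinuous _ _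

lemma ae_noiseMeasure_left {p : ℝ × Plane → Prop} (h : ∀ᵐ x, p x) :
    ∀ᵐ q ∂noiseMeasure f, p (q.1, q.2.1) := by
  apply noiseMeasure_absolutelyContinuous.ae_le
  have h1 : Measure.QuasiMeasurePreserving
      (Prod.map (id : ℝ → ℝ) (Prod.fst : Plane × Plane → Plane))
      ((volume.restrict (Ioi 0)).prod (volume.prod volume)) (volume.prod volume) :=
    QuasiMeasurePreserving.prodMap
      ⟨measurable_id, by simpa using Measure.restrict_le_self.absolutelyContinuous⟩
      Measure.quasiMeasurePreserving_fst
  exact h1.ae h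

lemma ae_noiseMeasure_right {p : ℝ × Plane → Prop} (h : ∀ᵐ x, p x) :
    ∀ᵐ q ∂noiseMeasure f, p (q.1, q.2.2) := by
  apply noiseMeasure_absolutelyContinuous.ae_le
  have h1 : Measure.QuasiMeasurePreserving
      (Prod.map (id : ℝ → ℝ) (Prod.snd : Plane × Plane → Plane))
      ((volume.restrict (Ioi 0)).prod (volume.prod volume)) (volume.prod volume) :=
    QuasiMeasurePreserving.prodMap
      ⟨measurable_id, by simpa using Measure.restrict_le_self.absolutelyContinuous⟩
      Measure.quasiMeasurePreserving_snd
  exact h1.ae h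

/-- The set of `(s, y, z)` with `(s, y)` and `(s, z)` in the ball of radius `R`. -/
def spaceTimeBox (R : ℝ) : Set (ℝ × Plane × Plane) :=
  Metric.closedBall 0 R ×ˢ Metric.closedBall 0 R ×ˢ Metric.closedBall 0 R

lemma measurableSet_spaceTimeBox (R : ℝ) : MeasurableSet (spaceTimeBox R) :=
  Metric.isClosed_closedBall.measurableSet.prod
    (Metric.isClosed_closedBall.measurableSet.prod Metric.isClosed_closedBall.measurableSet)

lemma IsNoiseKernel.noiseMeasure_box_lt_top (hf : IsNoiseKernel f) (R : ℝ) :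
    noiseMeasure f (spaceTimeBox R) < ∞ := by
  rw [← lintegral_indicator_one (measurableSet_spaceTimeBox R),
    lintegral_noiseMeasure hf.measurable
      (measurable_one.indicator (measurableSet_spaceTimeBox R))]
  set c := ∫⁻ w in Metric.closedBall (0 : Plane) (2 * R), ENNReal.ofReal (f ‖w‖)
  have hc : c < ∞ := hf.lintegral_ball_lt_top _
  have key : ∀ s : ℝ, ∀ y : Plane, ∫⁻ z : Plane,
      (spaceTimeBox R).indicator 1 (s, y, z) * ENNReal.ofReal (f ‖y - z‖) ≤
      (Metric.closedBall (0 : ℝ) R).indicator 1 s *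
        ((Metric.closedBall (0 : Plane) R).indicator 1 y * c) := by
    intro s y
    by_cases hs : s ∈ Metric.closedBall (0 : ℝ) R
    · by_cases hy : y ∈ Metric.closedBall (0 : Plane) R
      · simp only [indicator_of_mem hs, indicator_of_mem hy, Pi.one_apply, one_mul]
        have : c = ∫⁻ z : Plane, (Metric.closedBall (0 : Plane) (2 * R)).indicator
            (fun w => ENNReal.ofReal (f ‖w‖)) (y - z) := by
          rw [lintegral_sub_left_eq_self (fun w => (Metric.closedBall (0 : Plane)
            (2 * R)).indicator (fun w => ENNReal.ofReal (f ‖w‖)) w) y,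
            lintegral_indicator Metric.isClosed_closedBall.measurableSet]
        rw [this]
        refine lintegral_mono fun z => ?_
        by_cases hz : z ∈ Metric.closedBall (0 : Plane) R
        · have : y - z ∈ Metric.closedBall (0 : Plane) (2 * R) := by
            rw [mem_closedBall_zero_iff] at *
            linarith [norm_sub_le y z]
          simp only [indicator_of_mem this]
          refine (mul_le_mul_left (indicator_le_self' (by simp) _) _).trans ?_
          simp
        · have : (s, y, z) ∉ spaceTimeBox R := fun h => hz h.2.2
          simp [indicator_of_notMem this]
      · have : ∀ z, (s, y, z) ∉ spaceTimeBox R := fun z h => hy h.2.1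
        simp [this]
    · have : ∀ z, (s, y, z) ∉ spaceTimeBox R := fun z h => hs h.1
      simp [this]
  calc _ ≤ ∫⁻ s in Ioi (0 : ℝ), ∫⁻ y : Plane, (Metric.closedBall (0 : ℝ) R).indicator 1 s *
        ((Metric.closedBall (0 : Plane) R).indicator 1 y * c) :=
        lintegral_mono fun s => lintegral_mono fun y => key s y
    _ ≤ ∫⁻ s : ℝ, ∫⁻ y : Plane, (Metric.closedBall (0 : ℝ) R).indicator 1 s *
        ((Metric.closedBall (0 : Plane) R).indicator 1 y * c) := setLIntegral_le_lintegral _ _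
    _ = volume (Metric.closedBall (0 : ℝ) R) * (volume (Metric.closedBall (0 : Plane) R) * c) := by
        have h1 : Measurable ((Metric.closedBall (0 : ℝ) R).indicator (1 : ℝ → ℝ≥0∞)) :=
          measurable_one.indicator Metric.isClosed_closedBall.measurableSet
        have h2 : Measurable ((Metric.closedBall (0 : Plane) R).indicator (1 : Plane → ℝ≥0∞)) :=
          measurable_one.indicator Metric.isClosed_closedBall.measurableSet
        simp_rw [lintegral_const_mul _ (h2.mul_const c), lintegral_mul_const _ h2]
        rw [lintegral_mul_const _ h1, lintegral_indicator_one Metric.isClosed_closedBall.measurableSet,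
          lintegral_indicator_one Metric.isClosed_closedBall.measurableSet]
    _ < ∞ := ENNReal.mul_lt_top measure_closedBall_lt_top
        (ENNReal.mul_lt_top measure_closedBall_lt_top hc)

end NoiseMeasure

/-- Bounded measurable functions of bounded support are limits almost everywhere of test functions
with the same bound and uniformly bounded supports. -/
lemma exists_testFn_tendsto {h : ℝ × Plane → ℝ} (hm : Measurable h) {M R : ℝ}
    (hM : ∀ p, |h p| ≤ M) (hR : ∀ p, h p ≠ 0 → ‖p‖ ≤ R) :
    ∃ φ : ℕ → TestFn, (∀ n p, |φ n p| ≤ M) ∧ (∀ n p, φ n p ≠ 0 → ‖p‖ ≤ R + 1) ∧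
      ∀ᵐ p, Tendsto (fun n => φ n p) atTop (𝓝 (h p)) := by
  obtain ⟨μ, hμ, hμv⟩ : ∃ μ : Measure (ℝ × Plane), μ.IsAddHaarMeasure ∧ volume = μ :=
    ⟨(volume : Measure ℝ).prod (volume : Measure Plane), inferInstance, rfl⟩
  have hint : Integrable h μ := by
    have h1 : IntegrableOn h (Metric.closedBall 0 R) μ :=
      Measure.integrableOn_of_bounded (M := M) measure_closedBall_lt_top.ne
        hm.aestronglyMeasurable (Eventually.of_forall fun p => hM p)
    refine (integrableOn_iff_integrable_of_support_subset fun p hp => ?_).1 h1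
    simpa using hR p hp
  let b : ℕ → ContDiffBump (0 : ℝ × Plane) := fun n =>
    ⟨1 / (2 * (n + 1)), 1 / (n + 1), by positivity, by
      apply one_div_lt_one_div_of_lt <;> · have : (0 : ℝ) ≤ n := n.cast_nonneg
                                           linarith⟩
  have hb : Tendsto (fun n => (b n).rOut) atTop (𝓝 0) := tendsto_one_div_add_atTop_nhds_zero_nat
  let g : ℕ → ℝ × Plane → ℝ := fun n =>
    MeasureTheory.convolution ((b n).normed μ) h (ContinuousLinearMap.lsmul ℝ ℝ) μ
  have hg_supp : ∀ n p, g n p ≠ 0 → ‖p‖ ≤ R + 1 := by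
    intro n p hp
    obtain ⟨u, hu, v, hv, rfl⟩ := support_convolution_subset (ContinuousLinearMap.lsmul ℝ ℝ) hp
    have h1 := hR v hv
    rw [(b n).support_normed_eq, mem_ball_zero_iff] at hu
    have h2 : (b n).rOut ≤ 1 := by
      change 1 / ((n : ℝ) + 1) ≤ 1
      rw [div_le_one (by positivity)]
      linarith [(n.cast_nonneg : (0 : ℝ) ≤ n)]
    linarith [norm_add_le u v]
  have hg_cs : ∀ n, HasCompactSupport (g n) := fun n =>
    HasCompactSupport.intro (isCompact_closedBall (0 : ℝ × Plane) (R + 1)) fun p hp => by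
      by_contra h0
      exact hp (by simpa using hg_supp n p h0)
  have hg_smooth : ∀ n, ContDiff ℝ ((⊤ : ℕ∞) : WithTop ℕ∞) (g n) := fun n =>
    (b n).hasCompactSupport_normed.contDiff_convolution_left _ (b n).contDiff_normed
      hint.locallyIntegrable
  refine ⟨fun n => ⟨g n, hg_smooth n, hg_cs n, by simp⟩, fun n p => ?_, hg_supp, ?_⟩
  · change ‖∫ t, (b n).normed μ t • h (p - t) ∂μ‖ ≤ M
    calc ‖∫ t, (b n).normed μ t • h (p - t) ∂μ‖ ≤ ∫ t, (b n).normed μ t * M ∂μ := by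
          refine norm_integral_le_of_norm_le ((b n).integrable_normed.mul_const M)
            (Eventually.of_forall fun t => ?_)
          rw [norm_smul, Real.norm_of_nonneg ((b n).nonneg_normed t)]
          exact mul_le_mul_of_nonneg_left (hM _) ((b n).nonneg_normed t)
      _ = M := by rw [integral_mul_const, (b n).integral_normed, one_mul]
  · rw [hμv]
    refine ContDiffBump.ae_convolution_tendsto_right_of_locallyIntegrable (μ := μ) (K := 2) hb
      (Eventually.of_forall fun n => ?_) hint.locallyIntegrable
    change 1 / ((n : ℝ) + 1) ≤ 2 * (1 / (2 * (n + 1)))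
    apply le_of_eq
    field_simp

/-- The bilinear form whose diagonal is `walshNormSq`. -/
noncomputable def walshForm (f : ℝ → ℝ) (g h : ℝ × Plane → ℝ) : ℝ≥0∞ :=
  ∫⁻ q, ‖g (q.1, q.2.1)‖ₑ * ‖h (q.1, q.2.2)‖ₑ ∂noiseMeasure f

/-- The quadratic form of the noise is nonnegative on test functions. -/
def IsPositiveOnTestFn (f : ℝ → ℝ) : Prop :=
  ∀ φ : TestFn, 0 ≤ ∫ q, φ (q.1, q.2.1) * φ (q.1, q.2.2) ∂noiseMeasure f

section WalshForm

variable {f : ℝ → ℝ}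

lemma walshForm_comm (hf : Measurable f) {g h : ℝ × Plane → ℝ} (hg : Measurable g)
    (hh : Measurable h) : walshForm f g h = walshForm f h g := by
  rw [walshForm, walshForm, lintegral_noiseMeasure hf (by fun_prop),
    lintegral_noiseMeasure hf (by fun_prop)]
  refine lintegral_congr fun s => ?_
  rw [lintegral_lintegral_swap]
  · refine lintegral_congr fun y => lintegral_congr fun z => ?_
    rw [norm_sub_rev, mul_comm ‖g _‖ₑ]
  · have : Measurable (fun p : Plane × Plane => ‖p.1 - p.2‖) := by fun_prop
    have h2 := (hf.comp this).ennreal_ofReal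
    exact Measurable.aemeasurable (by
      simp only [Function.uncurry_def]
      exact Measurable.mul (by fun_prop) h2)

lemma mem_spaceTimeBox {R : ℝ} {q : ℝ × Plane × Plane} (h1 : ‖(q.1, q.2.1)‖ ≤ R)
    (h2 : ‖(q.1, q.2.2)‖ ≤ R) : q ∈ spaceTimeBox R := by
  simp only [Prod.norm_def, sup_le_iff] at h1 h2
  simpa [spaceTimeBox, h2.2] using h1

lemma norm_mul_le_indicator_box {u v : ℝ × Plane → ℝ} {M R : ℝ} (hM : 0 ≤ M)
    (huM : ∀ p, |u p| ≤ M) (hvM : ∀ p, |v p| ≤ M)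
    (huR : ∀ p, u p ≠ 0 → ‖p‖ ≤ R) (hvR : ∀ p, v p ≠ 0 → ‖p‖ ≤ R) (q : ℝ × Plane × Plane) :
    ‖u (q.1, q.2.1) * v (q.1, q.2.2)‖ ≤ (spaceTimeBox R).indicator (fun _ => M * M) q := by
  by_cases hq : q ∈ spaceTimeBox R
  · rw [indicator_of_mem hq, norm_mul]
    exact mul_le_mul (huM _) (hvM _) (norm_nonneg _) hM
  · rw [indicator_of_notMem hq]
    have : u (q.1, q.2.1) = 0 ∨ v (q.1, q.2.2) = 0 := by
      by_contra! h
      exact hq (mem_spaceTimeBox (huR _ h.1) (hvR _ h.2))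
    rcases this with h | h <;> simp [h]

lemma IsNoiseKernel.integrable_indicator_box (hf : IsNoiseKernel f) (R c : ℝ) :
    Integrable ((spaceTimeBox R).indicator (fun _ => c)) (noiseMeasure f) :=
  (integrable_indicator_iff (measurableSet_spaceTimeBox R)).2
    (integrableOn_const (hf.noiseMeasure_box_lt_top R).ne)

lemma IsNoiseKernel.integrable_mul (hf : IsNoiseKernel f) {u v : ℝ × Plane → ℝ} {M R : ℝ}
    (hu : Measurable u) (hv : Measurable v) (hM : 0 ≤ M)
    (huM : ∀ p, |u p| ≤ M) (hvM : ∀ p, |v p| ≤ M)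
    (huR : ∀ p, u p ≠ 0 → ‖p‖ ≤ R) (hvR : ∀ p, v p ≠ 0 → ‖p‖ ≤ R) :
    Integrable (fun q => u (q.1, q.2.1) * v (q.1, q.2.2)) (noiseMeasure f) :=
  (hf.integrable_indicator_box R (M * M)).mono'
    (Measurable.aestronglyMeasurable (by fun_prop))
    (Eventually.of_forall (norm_mul_le_indicator_box hM huM hvM huR hvR))

lemma TestFn.exists_bound (φ : TestFn) :
    ∃ M R : ℝ, 0 ≤ M ∧ (∀ p, |φ p| ≤ M) ∧ ∀ p, φ p ≠ 0 → ‖p‖ ≤ R := by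
  obtain ⟨C, hC⟩ := φ.continuous.bounded_above_of_compact_support φ.hasCompactSupport
  obtain ⟨R, hR⟩ := φ.hasCompactSupport.isBounded.exists_norm_le
  exact ⟨C, R, (norm_nonneg _).trans (hC 0), hC, fun p hp => hR p (subset_tsupport _ hp)⟩

lemma IsNoiseKernel.integrable_testFn_mul (hf : IsNoiseKernel f) (φ ψ : TestFn) :
    Integrable (fun q => φ (q.1, q.2.1) * ψ (q.1, q.2.2)) (noiseMeasure f) := by
  obtain ⟨M, R, hM, h1, h2⟩ := TestFn.exists_bound φ
  obtain ⟨M', R', hM', h1', h2'⟩ := TestFn.exists_bound ψ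
  exact hf.integrable_mul (M := max M M') (R := max R R') φ.continuous.measurable
    ψ.continuous.measurable (hM.trans (le_max_left _ _))
    (fun p => (h1 p).trans (le_max_left _ _)) (fun p => (h1' p).trans (le_max_right _ _))
    (fun p hp => (h2 p hp).trans (le_max_left _ _))
    (fun p hp => (h2' p hp).trans (le_max_right _ _))

lemma IsNoiseKernel.integral_mul_self_nonneg (hf : IsNoiseKernel f) (hpos : IsPositiveOnTestFn f)
    {h : ℝ × Plane → ℝ} (hm : Measurable h) {M R : ℝ} (hM0 : 0 ≤ M) (hM : ∀ p, |h p| ≤ M)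
    (hR : ∀ p, h p ≠ 0 → ‖p‖ ≤ R) :
    0 ≤ ∫ q, h (q.1, q.2.1) * h (q.1, q.2.2) ∂noiseMeasure f := by
  obtain ⟨φ, h1, h2, h3⟩ := exists_testFn_tendsto hm hM hR
  have := tendsto_integral_of_dominated_convergence (μ := noiseMeasure f)
    (F := fun n q => φ n (q.1, q.2.1) * φ n (q.1, q.2.2))
    (f := fun q => h (q.1, q.2.1) * h (q.1, q.2.2)) _
    (fun n => (hf.integrable_testFn_mul (φ n) (φ n)).aestronglyMeasurable)
    (hf.integrable_indicator_box (R + 1) (M * M))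
    (fun n => Eventually.of_forall
      (norm_mul_le_indicator_box hM0 (h1 n) (h1 n) (h2 n) (h2 n)))
    (by filter_upwards [ae_noiseMeasure_left h3, ae_noiseMeasure_right h3] with q hq hq'
        exact hq.mul hq')
  exact ge_of_tendsto' this fun n => hpos (φ n)

lemma IsNoiseKernel.walshForm_le_of_bounded (hf : IsNoiseKernel f) (hpos : IsPositiveOnTestFn f)
    {u v : ℝ × Plane → ℝ} {M R : ℝ} (hu : Measurable u) (hv : Measurable v) (hM : 0 ≤ M)
    (hu0 : ∀ p, 0 ≤ u p) (hv0 : ∀ p, 0 ≤ v p)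
    (huM : ∀ p, u p ≤ M) (hvM : ∀ p, v p ≤ M)
    (huR : ∀ p, u p ≠ 0 → ‖p‖ ≤ R) (hvR : ∀ p, v p ≠ 0 → ‖p‖ ≤ R) :
    2 * walshForm f u v ≤ walshForm f u u + walshForm f v v := by
  have huM' : ∀ p, |u p| ≤ M := fun p => by rw [abs_of_nonneg (hu0 p)]; exact huM p
  have hvM' : ∀ p, |v p| ≤ M := fun p => by rw [abs_of_nonneg (hv0 p)]; exact hvM p
  have key : ∀ g h : ℝ × Plane → ℝ, (∀ p, 0 ≤ g p) → (∀ p, 0 ≤ h p) →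
      Integrable (fun q => g (q.1, q.2.1) * h (q.1, q.2.2)) (noiseMeasure f) →
      walshForm f g h = ENNReal.ofReal (∫ q, g (q.1, q.2.1) * h (q.1, q.2.2) ∂noiseMeasure f) := by
    intro g h hg hh hi
    rw [ofReal_integral_eq_lintegral_ofReal hi
      (Eventually.of_forall fun q => mul_nonneg (hg _) (hh _)), walshForm]
    refine lintegral_congr fun q => ?_
    rw [ENNReal.ofReal_mul (hg _), Real.enorm_of_nonneg (hg _), Real.enorm_of_nonneg (hh _)]
  have iuu := hf.integrable_mul hu hu hM huM' huM' huR huR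
  have iuv := hf.integrable_mul hu hv hM huM' hvM' huR hvR
  have ivu := hf.integrable_mul hv hu hM hvM' huM' hvR huR
  have ivv := hf.integrable_mul hv hv hM hvM' hvM' hvR hvR
  have hsymm : walshForm f u v = walshForm f v u := walshForm_comm hf.measurable hu hv
  have h0 := hf.integral_mul_self_nonneg hpos (h := fun p => u p - v p) (hu.sub hv)
    (M := M) (R := R) hM (fun p => abs_le.2 ⟨by linarith [hu0 p, hvM p], by linarith [hv0 p, huM p]⟩)
    (fun p hp => by
      by_cases h : u p = 0
      · exact hvR p fun h' => hp (by simp [h, h'])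
      · exact huR p h)
  have hexp : ∫ q, (u (q.1, q.2.1) - v (q.1, q.2.1)) * (u (q.1, q.2.2) - v (q.1, q.2.2))
        ∂noiseMeasure f =
      ((∫ q, u (q.1, q.2.1) * u (q.1, q.2.2) ∂noiseMeasure f)
        + ∫ q, v (q.1, q.2.1) * v (q.1, q.2.2) ∂noiseMeasure f)
      - ((∫ q, u (q.1, q.2.1) * v (q.1, q.2.2) ∂noiseMeasure f)
        + ∫ q, v (q.1, q.2.1) * u (q.1, q.2.2) ∂noiseMeasure f) := by
    rw [← integral_add iuu ivv, ← integral_add iuv ivu, ← integral_sub (iuu.fun_add ivv) (iuv.fun_add ivu)]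
    refine integral_congr_ae (Eventually.of_forall fun q => ?_)
    ring
  rw [hexp] at h0
  rw [two_mul]
  nth_rewrite 2 [hsymm]
  have nn : ∀ g h : ℝ × Plane → ℝ, (∀ p, 0 ≤ g p) → (∀ p, 0 ≤ h p) →
      0 ≤ ∫ q, g (q.1, q.2.1) * h (q.1, q.2.2) ∂noiseMeasure f :=
    fun g h hg hh => integral_nonneg fun q => mul_nonneg (hg _) (hh _)
  rw [key u v hu0 hv0 iuv, key v u hv0 hu0 ivu, key u u hu0 hu0 iuu, key v v hv0 hv0 ivv,
    ← ENNReal.ofReal_add (nn u v hu0 hv0) (nn v u hv0 hu0),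
    ← ENNReal.ofReal_add (nn u u hu0 hu0) (nn v v hv0 hv0)]
  exact ENNReal.ofReal_le_ofReal (by linarith)

/-- Truncation of `|g|` to a bounded function of bounded support. -/
noncomputable def absTrunc (g : ℝ × Plane → ℝ) (n : ℕ) : ℝ × Plane → ℝ :=
  (Metric.closedBall 0 (n : ℝ)).indicator fun p => min |g p| n

lemma measurable_absTrunc {g : ℝ × Plane → ℝ} (hg : Measurable g) (n : ℕ) :
    Measurable (absTrunc g n) :=
  Measurable.indicator (by simp_rw [← Real.norm_eq_abs]; fun_prop)
    Metric.isClosed_closedBall.measurableSet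

lemma absTrunc_nonneg (g : ℝ × Plane → ℝ) (n : ℕ) (p) : 0 ≤ absTrunc g n p :=
  indicator_nonneg (fun _ _ => by positivity) _

lemma absTrunc_le (g : ℝ × Plane → ℝ) (n : ℕ) (p) : absTrunc g n p ≤ n :=
  indicator_le' (fun _ _ => min_le_right _ _) (fun _ _ => n.cast_nonneg) p

lemma absTrunc_le_abs (g : ℝ × Plane → ℝ) (n : ℕ) (p) : absTrunc g n p ≤ |g p| :=
  indicator_le' (fun _ _ => min_le_left _ _) (fun _ _ => abs_nonneg _) p

lemma norm_le_of_absTrunc_ne_zero (g : ℝ × Plane → ℝ) (n : ℕ) (p) (h : absTrunc g n p ≠ 0) :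
    ‖p‖ ≤ n := by
  simpa using mem_of_indicator_ne_zero h

lemma enorm_absTrunc_le (g : ℝ × Plane → ℝ) (n : ℕ) (p) : ‖absTrunc g n p‖ₑ ≤ ‖g p‖ₑ := by
  rw [enorm_le_iff_norm_le, Real.norm_of_nonneg (absTrunc_nonneg g n p)]
  exact absTrunc_le_abs g n p

lemma eventually_enorm_absTrunc_eq (g : ℝ × Plane → ℝ) (p) :
    ∀ᶠ n in atTop, ‖absTrunc g n p‖ₑ = ‖g p‖ₑ := by
  obtain ⟨N, hN⟩ := exists_nat_ge (max ‖p‖ |g p|)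
  filter_upwards [eventually_ge_atTop N] with n hn
  have hn' : max ‖p‖ |g p| ≤ n := hN.trans (by exact_mod_cast hn)
  rw [absTrunc, indicator_of_mem (by simpa using (le_max_left _ _).trans hn'),
    min_eq_left ((le_max_right _ _).trans hn')]
  simp

lemma IsNoiseKernel.two_mul_walshForm_le (hf : IsNoiseKernel f) (hpos : IsPositiveOnTestFn f)
    {g h : ℝ × Plane → ℝ} (hg : Measurable g) (hh : Measurable h) :
    2 * walshForm f g h ≤ walshForm f g g + walshForm f h h := by
  have hb : ∀ n, 2 * walshForm f (absTrunc g n) (absTrunc h n) ≤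
      walshForm f g g + walshForm f h h := fun n =>
    (hf.walshForm_le_of_bounded hpos (measurable_absTrunc hg n) (measurable_absTrunc hh n)
      n.cast_nonneg (absTrunc_nonneg g n) (absTrunc_nonneg h n) (absTrunc_le g n)
      (absTrunc_le h n) (norm_le_of_absTrunc_ne_zero g n)
      (norm_le_of_absTrunc_ne_zero h n)).trans
      (add_le_add
        (lintegral_mono fun q => mul_le_mul' (enorm_absTrunc_le _ _ _) (enorm_absTrunc_le _ _ _))
        (lintegral_mono fun q => mul_le_mul' (enorm_absTrunc_le _ _ _) (enorm_absTrunc_le _ _ _)))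
  have hfatou : walshForm f g h ≤
      liminf (fun n => walshForm f (absTrunc g n) (absTrunc h n)) atTop := by
    refine le_trans (le_of_eq ?_) (lintegral_liminf_le fun n => ?_)
    · refine lintegral_congr fun q => ?_
      refine (Tendsto.liminf_eq (tendsto_const_nhds.congr' ?_)).symm
      filter_upwards [eventually_enorm_absTrunc_eq g (q.1, q.2.1),
        eventually_enorm_absTrunc_eq h (q.1, q.2.2)] with n h1 h2
      rw [h1, h2]
    · have := measurable_absTrunc hg n
      have := measurable_absTrunc hh n
      fun_prop
  have hlim : liminf (fun n => walshForm f (absTrunc g n) (absTrunc h n)) atTop ≤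
      (walshForm f g g + walshForm f h h) / 2 := by
    refine (liminf_le_liminf (Eventually.of_forall fun n => ?_)).trans (liminf_const _).le
    rw [ENNReal.le_div_iff_mul_le (by simp) (by simp), mul_comm]
    exact hb n
  rw [mul_comm, ← ENNReal.le_div_iff_mul_le (by simp) (by simp)]
  exact hfatou.trans hlim

lemma IsNoiseKernel.walshForm_add_le (hf : IsNoiseKernel f) (hpos : IsPositiveOnTestFn f)
    {g h : ℝ × Plane → ℝ} (hg : Measurable g) (hh : Measurable h) :
    walshForm f (fun p => g p + h p) (fun p => g p + h p) ≤
      2 * walshForm f g g + 2 * walshForm f h h := by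
  have hsymm : walshForm f h g = walshForm f g h := walshForm_comm hf.measurable hh hg
  calc walshForm f (fun p => g p + h p) (fun p => g p + h p)
      ≤ ∫⁻ q, (‖g (q.1, q.2.1)‖ₑ * ‖g (q.1, q.2.2)‖ₑ + ‖g (q.1, q.2.1)‖ₑ * ‖h (q.1, q.2.2)‖ₑ)
        + (‖h (q.1, q.2.1)‖ₑ * ‖g (q.1, q.2.2)‖ₑ + ‖h (q.1, q.2.1)‖ₑ * ‖h (q.1, q.2.2)‖ₑ)
        ∂noiseMeasure f := by
        refine lintegral_mono fun q => ?_
        refine (mul_le_mul' (enorm_add_le _ _) (enorm_add_le _ _)).trans (le_of_eq ?_)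
        ring
    _ = (walshForm f g g + walshForm f g h) + (walshForm f h g + walshForm f h h) := by
        rw [lintegral_add_left (by fun_prop), lintegral_add_left (by fun_prop),
          lintegral_add_left (by fun_prop)]
        rfl
    _ = walshForm f g g + 2 * walshForm f g h + walshForm f h h := by rw [hsymm]; ring
    _ ≤ walshForm f g g + (walshForm f g g + walshForm f h h) + walshForm f h h := by
        gcongr
        exact hf.two_mul_walshForm_le hpos hg hh
    _ = _ := by ring

lemma walshNormSq_eq_walshForm (hf : Measurable f) {g : ℝ × Plane → ℝ} (hg : Measurable g) :
    walshNormSq f g = walshForm f g g := walshNormSq_eq_lintegral hf hg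

lemma walshForm_mono {g h : ℝ × Plane → ℝ} (hgh : ∀ p, |g p| ≤ |h p|) :
    walshForm f g g ≤ walshForm f h h :=
  lintegral_mono fun _ => mul_le_mul' (enorm_le_iff_norm_le.2 (hgh _))
    (enorm_le_iff_norm_le.2 (hgh _))

/-- Integrands of finite norm and bounded support are approximated by test functions. -/
lemma IsNoiseKernel.exists_testFn_tendsto_walshForm (hf : IsNoiseKernel f)
    (hpos : IsPositiveOnTestFn f) {g : ℝ × Plane → ℝ} (hg : Measurable g) {R : ℝ}
    (hR : ∀ p, g p ≠ 0 → ‖p‖ ≤ R) (hfin : walshForm f g g ≠ ∞) :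
    ∃ φ : ℕ → TestFn, Tendsto (fun n => walshForm f (fun p => φ n p - g p)
      (fun p => φ n p - g p)) atTop (𝓝 0) := by
  let c : ℕ → ℝ × Plane → ℝ := fun n p => max (-n) (min (g p) n)
  have hc : ∀ n, Measurable (c n) := fun n => by fun_prop
  have habs : ∀ n p, |c n p - g p| ≤ |g p| := by
    intro n p
    have hn : (0 : ℝ) ≤ n := n.cast_nonneg
    simp only [c]
    rcases max_cases (-(n : ℝ)) (min (g p) n) with ⟨h1, h2⟩ | ⟨h1, h2⟩ <;>
      rcases min_cases (g p) (n : ℝ) with ⟨h3, h4⟩ | ⟨h3, h4⟩ <;>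
      rw [h1] <;> try rw [h3]
    all_goals
      rcases abs_cases (g p) with ⟨h5, h6⟩ | ⟨h5, h6⟩ <;> rw [h5, abs_le] <;>
        constructor <;> linarith
  have hev : ∀ p, ∀ᶠ n in atTop, c n p - g p = 0 := by
    intro p
    obtain ⟨N, hN⟩ := exists_nat_ge |g p|
    filter_upwards [eventually_ge_atTop N] with n hn
    have hn' : |g p| ≤ n := hN.trans (by exact_mod_cast hn)
    rw [abs_le] at hn'
    simp [c, hn'.1, hn'.2]
  have htrunc : Tendsto (fun n => walshForm f (fun p => c n p - g p) (fun p => c n p - g p))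
      atTop (𝓝 0) := by
    have := tendsto_lintegral_of_dominated_convergence (μ := noiseMeasure f)
      (F := fun n q => ‖c n (q.1, q.2.1) - g (q.1, q.2.1)‖ₑ * ‖c n (q.1, q.2.2) - g (q.1, q.2.2)‖ₑ)
      (f := fun _ => 0) (fun q => ‖g (q.1, q.2.1)‖ₑ * ‖g (q.1, q.2.2)‖ₑ)
      (fun n => by have := hc n; fun_prop)
      (fun n => Eventually.of_forall fun q => mul_le_mul'
        (enorm_le_iff_norm_le.2 (habs _ _)) (enorm_le_iff_norm_le.2 (habs _ _))) hfin
      (Eventually.of_forall fun q => by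
        refine tendsto_const_nhds.congr' ?_
        filter_upwards [hev (q.1, q.2.1)] with n hn
        simp [hn])
    simpa only [walshForm, lintegral_zero] using this
  have happrox : ∀ n, ∃ φ : ℕ → TestFn, Tendsto (fun k => walshForm f
      (fun p => φ k p - c n p) (fun p => φ k p - c n p)) atTop (𝓝 0) := by
    intro n
    have hcM : ∀ p, |c n p| ≤ n := fun p => by
      have hn : (0 : ℝ) ≤ n := n.cast_nonneg
      exact abs_le.2 ⟨le_max_left _ _, max_le (by linarith) (min_le_right _ _)⟩
    have hcR : ∀ p, c n p ≠ 0 → ‖p‖ ≤ R := fun p hp => hR p fun h => hp (by simp [c, h])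
    obtain ⟨φ, h1, h2, h3⟩ := exists_testFn_tendsto (hc n) hcM hcR
    refine ⟨φ, ?_⟩
    have := tendsto_lintegral_of_dominated_convergence (μ := noiseMeasure f)
      (F := fun k q => ‖φ k (q.1, q.2.1) - c n (q.1, q.2.1)‖ₑ *
        ‖φ k (q.1, q.2.2) - c n (q.1, q.2.2)‖ₑ)
      (f := fun _ => 0)
      (fun q => ‖(spaceTimeBox (R + 1)).indicator (fun _ => (2 * n : ℝ) * (2 * n)) q‖ₑ)
      (fun k => by
        have h4 := hc n
        have h5 := (φ k).continuous.measurable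
        fun_prop)
      (fun k => Eventually.of_forall fun q => by
        beta_reduce
        rw [← enorm_mul, enorm_le_iff_norm_le]
        refine (norm_mul_le_indicator_box (u := fun p => φ k p - c n p)
          (v := fun p => φ k p - c n p) (M := 2 * n) (R := R + 1) (by positivity) ?_ ?_ ?_ ?_
          q).trans (le_abs_self _)
        any_goals
          intro p
          exact (abs_sub _ _).trans (by linarith [h1 k p, hcM p])
        all_goals
          intro p hp
          by_cases h : φ k p = 0
          · have := hcR p fun h' => hp (by simp [h, h'])
            linarith
          · exact h2 k p h)
      (hf.integrable_indicator_box (R + 1) _).hasFiniteIntegral.ne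
      (by
        filter_upwards [ae_noiseMeasure_left h3, ae_noiseMeasure_right h3] with q hq hq'
        have e1 := ((hq.sub_const (c n (q.1, q.2.1))).enorm)
        have e2 := ((hq'.sub_const (c n (q.1, q.2.2))).enorm)
        simp only [sub_self, enorm_zero] at e1 e2
        simpa using ENNReal.Tendsto.mul e1 (by simp) e2 (by simp))
    simpa only [walshForm, lintegral_zero] using this
  have hex : ∀ k : ℕ, ∃ φ : TestFn,
      walshForm f (fun p => φ p - g p) (fun p => φ p - g p) ≤ ENNReal.ofReal (1 / (k + 1)) := by
    intro k
    have hε : (0 : ℝ≥0∞) < ENNReal.ofReal (1 / (k + 1)) / 4 := by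
      refine ENNReal.div_pos (ENNReal.ofReal_pos.2 (by positivity)).ne' (by simp)
    obtain ⟨n, hn⟩ := (htrunc.eventually (ge_mem_nhds hε)).exists
    obtain ⟨φ, hφ⟩ := happrox n
    obtain ⟨j, hj⟩ := (hφ.eventually (ge_mem_nhds hε)).exists
    refine ⟨φ j, ?_⟩
    have h4 := hf.walshForm_add_le hpos (g := fun p => φ j p - c n p) (h := fun p => c n p - g p)
      ((φ j).continuous.measurable.sub (hc n)) ((hc n).sub hg)
    simp only [sub_add_sub_cancel] at h4
    refine h4.trans ((add_le_add (mul_le_mul_right hj 2) (mul_le_mul_right hn 2)).trans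
      (le_of_eq ?_))
    rw [← add_mul, ← ENNReal.mul_comm_div, mul_comm]
    norm_num
    rw [ENNReal.div_self (by simp) (by simp), mul_one]
  choose φ hφ using hex
  refine ⟨φ, tendsto_of_tendsto_of_tendsto_of_le_of_le tendsto_const_nhds ?_
    (fun _ => zero_le) hφ⟩
  have := ENNReal.tendsto_ofReal (tendsto_one_div_add_atTop_nhds_zero_nat (𝕜 := ℝ))
  simpa using this

end WalshForm

/-- The `L^p` norm of a standard Gaussian variable. -/
noncomputable def gaussianMoment (p : ℝ≥0∞) : ℝ≥0∞ := eLpNorm id p (gaussianReal 0 1)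

lemma gaussianMoment_ne_top {p : ℝ≥0∞} (hp : p ≠ ∞) : gaussianMoment p ≠ ∞ :=
  (memLp_id_gaussianReal' p hp).eLpNorm_ne_top

lemma eLpNorm_of_hasGaussianLaw {Ω : Type*} [MeasurableSpace Ω] {P : Measure Ω} {Z : Ω → ℝ}
    (hZ : HasGaussianLaw Z P) (h0 : ∫ ω, Z ω ∂P = 0) (p : ℝ≥0∞) :
    eLpNorm Z p P = gaussianMoment p * ENNReal.ofReal (∫ ω, Z ω ^ 2 ∂P) ^ (1 / 2 : ℝ) := by
  have hvar := variance_of_integral_eq_zero hZ.aemeasurable h0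
  have hnn : 0 ≤ ∫ ω, Z ω ^ 2 ∂P := integral_nonneg fun ω => sq_nonneg _
  set v := ∫ ω, Z ω ^ 2 ∂P
  have hmap : P.map Z = (gaussianReal 0 1).map (fun x => √v * x) := by
    rw [hZ.map_eq_gaussianReal, h0, hvar, gaussianReal_map_const_mul]
    congr 1
    · simp
    · ext
      simp [Real.sq_sqrt hnn, Real.coe_toNNReal _ hnn]
  have h1 : eLpNorm Z p P = eLpNorm id p (P.map Z) := by
    rw [eLpNorm_map_measure (by fun_prop) hZ.aemeasurable]
    rfl
  rw [h1, hmap, eLpNorm_map_measure (by fun_prop) (by fun_prop)]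
  have h2 : (id ∘ fun x : ℝ => √v * x) = √v • (id : ℝ → ℝ) := by
    ext x
    simp
  rw [h2, eLpNorm_const_smul, gaussianMoment, mul_comm]
  congr 1
  rw [Real.enorm_of_nonneg (Real.sqrt_nonneg _), Real.sqrt_eq_rpow,
    ENNReal.ofReal_rpow_of_nonneg hnn (by norm_num)]

section Noise

variable {f : ℝ → ℝ} {Ω : Type*} [MeasurableSpace Ω] {P : Measure Ω} {F : TestFn → Ω → ℝ}

lemma IsNoiseKernel.integral_testFn_mul (hf : IsNoiseKernel f) (φ ψ : TestFn) :
    ∫ q, φ (q.1, q.2.1) * ψ (q.1, q.2.2) ∂noiseMeasure f =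
      ∫ s in Ioi (0 : ℝ), ∫ x : Plane, ∫ y : Plane, φ (s, x) * f ‖x - y‖ * ψ (s, y) := by
  have hk := measurable_kernel hf.measurable
  have hlt : ∀ᵐ q : ℝ × Plane × Plane ∂(volume.restrict (Ioi 0)).prod (volume.prod volume),
      ENNReal.ofReal (f ‖q.2.1 - q.2.2‖) < ∞ := Eventually.of_forall fun q => by simp
  have hint := hf.integrable_testFn_mul φ ψ
  rw [noiseMeasure, integrable_withDensity_iff_integrable_smul' hk hlt] at hint
  rw [noiseMeasure, integral_withDensity_eq_integral_toReal_smul hk hlt, integral_prod _ hint]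
  refine integral_congr_ae ?_
  filter_upwards [hint.prod_right_ae] with s hs
  rw [integral_prod _ hs]
  refine integral_congr_ae (Eventually.of_forall fun x =>
    integral_congr_ae (Eventually.of_forall fun y => ?_))
  simp only [ENNReal.toReal_ofReal (hf.nonneg _), smul_eq_mul]
  ring

lemma IsSpatialGaussianNoise.covariance_eq (hF : IsSpatialGaussianNoise P f F)
    (hf : IsNoiseKernel f) (φ ψ : TestFn) :
    ∫ ω, F φ ω * F ψ ω ∂P = ∫ q, φ (q.1, q.2.1) * ψ (q.1, q.2.2) ∂noiseMeasure f := by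
  rw [hF.covariance, hf.integral_testFn_mul]

lemma IsSpatialGaussianNoise.isPositiveOnTestFn (hF : IsSpatialGaussianNoise P f F)
    (hf : IsNoiseKernel f) : IsPositiveOnTestFn f := fun φ => by
  rw [← hF.covariance_eq hf]
  exact integral_nonneg fun ω => mul_self_nonneg _

lemma IsSpatialGaussianNoise.memLp (hF : IsSpatialGaussianNoise P f F) (φ : TestFn)
    {p : ℝ≥0∞} (hp : p ≠ ∞) : MemLp (F φ) p P :=
  (hF.gaussian.hasGaussianLaw_eval φ).memLp hp

lemma IsSpatialGaussianNoise.integral_sub_sq (hF : IsSpatialGaussianNoise P f F)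
    (hf : IsNoiseKernel f) (φ ψ : TestFn) :
    ∫ ω, (F φ ω - F ψ ω) ^ 2 ∂P =
      ∫ q, (φ (q.1, q.2.1) - ψ (q.1, q.2.1)) * (φ (q.1, q.2.2) - ψ (q.1, q.2.2))
        ∂noiseMeasure f := by
  have hm : ∀ φ ψ : TestFn, Integrable (fun ω => F φ ω * F ψ ω) P := fun φ ψ =>
    (hF.memLp φ (p := 2) (by simp)).integrable_mul (hF.memLp ψ (p := 2) (by simp))
  have hi := hf.integrable_testFn_mul
  have e1 : ∫ ω, (F φ ω - F ψ ω) ^ 2 ∂P =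
      ((∫ ω, F φ ω * F φ ω ∂P) + ∫ ω, F ψ ω * F ψ ω ∂P)
        - ((∫ ω, F φ ω * F ψ ω ∂P) + ∫ ω, F ψ ω * F φ ω ∂P) := by
    rw [← integral_add (hm φ φ) (hm ψ ψ), ← integral_add (hm φ ψ) (hm ψ φ),
      ← integral_sub ((hm φ φ).fun_add (hm ψ ψ)) ((hm φ ψ).fun_add (hm ψ φ))]
    exact integral_congr_ae (Eventually.of_forall fun ω => by ring)
  rw [e1, hF.covariance_eq hf, hF.covariance_eq hf, hF.covariance_eq hf, hF.covariance_eq hf,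
    ← integral_add (hi φ φ) (hi ψ ψ), ← integral_add (hi φ ψ) (hi ψ φ),
    ← integral_sub ((hi φ φ).fun_add (hi ψ ψ)) ((hi φ ψ).fun_add (hi ψ φ))]
  exact integral_congr_ae (Eventually.of_forall fun ω => by ring)

/-- All moments of an increment of the noise are controlled by the norm of the increment. -/
lemma IsSpatialGaussianNoise.eLpNorm_increment_le (hF : IsSpatialGaussianNoise P f F)
    (hf : IsNoiseKernel f) (φ ψ : TestFn) (p : ℝ≥0∞) :
    eLpNorm (fun ω => F φ ω - F ψ ω) p P ≤ gaussianMoment p *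
      walshForm f (fun q => φ q - ψ q) (fun q => φ q - ψ q) ^ (1 / 2 : ℝ) := by
  have hint := fun φ => (hF.gaussian.hasGaussianLaw_eval φ).integrable
  rw [eLpNorm_of_hasGaussianLaw hF.gaussian.hasGaussianLaw_fun_sub
    (by rw [integral_sub (hint φ) (hint ψ), hF.centred, hF.centred, sub_zero])]
  gcongr
  rw [hF.integral_sub_sq hf]
  refine (ENNReal.ofReal_le_ofReal (le_abs_self _)).trans ?_
  rw [← Real.norm_eq_abs, ofReal_norm]
  refine (enorm_integral_le_lintegral_enorm _).trans (le_of_eq ?_)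
  simp only [enorm_mul]
  rfl

lemma walshForm_sub_comm (g h : ℝ × Plane → ℝ) :
    walshForm f (fun p => g p - h p) (fun p => g p - h p) =
      walshForm f (fun p => h p - g p) (fun p => h p - g p) := by
  simp only [walshForm, enorm_sub_rev]

/-- Integrands in the closure of the test functions have a stochastic integral. -/
lemma IsSpatialGaussianNoise.exists_isStochIntegral (hF : IsSpatialGaussianNoise P f F)
    (hf : IsNoiseKernel f) {g : ℝ × Plane → ℝ} (hg : Measurable g) {R : ℝ}
    (hR : ∀ p, g p ≠ 0 → ‖p‖ ≤ R) (hfin : walshForm f g g ≠ ∞) :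
    ∃ Y, IsStochIntegral P f F g Y := by
  have hpos := hF.isPositiveOnTestFn hf
  obtain ⟨φ, hφ⟩ := hf.exists_testFn_tendsto_walshForm hpos hg hR hfin
  set W : ℕ → ℝ≥0∞ := fun n => walshForm f (fun p => φ n p - g p) (fun p => φ n p - g p)
  have hm : ∀ n, MemLp (F (φ n)) 2 P := fun n => hF.memLp (φ n) (by simp)
  have hW : ∀ n m, eLpNorm (fun ω => F (φ n) ω - F (φ m) ω) 2 P ≤
      gaussianMoment 2 * (2 * W n + 2 * W m) ^ (1 / 2 : ℝ) := by
    intro n m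
    refine (hF.eLpNorm_increment_le hf _ _ 2).trans ?_
    gcongr
    have := hf.walshForm_add_le hpos (g := fun p => φ n p - g p) (h := fun p => g p - φ m p)
      ((φ n).continuous.measurable.sub hg) (hg.sub (φ m).continuous.measurable)
    simp only [sub_add_sub_cancel] at this
    rwa [walshForm_sub_comm g] at this
  have hcauchy : CauchySeq fun n => (hm n).toLp := by
    rw [Lp.cauchySeq_Lp_iff_cauchySeq_eLpNorm]
    have h2 : Tendsto (fun n : ℕ × ℕ => gaussianMoment 2 *
        (2 * W n.1 + 2 * W n.2) ^ (1 / 2 : ℝ)) atTop (𝓝 0) := by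
      have t1 : Tendsto (fun n : ℕ × ℕ => W n.1) atTop (𝓝 0) := by
        rw [← prod_atTop_atTop_eq]
        exact hφ.comp tendsto_fst
      have t2 : Tendsto (fun n : ℕ × ℕ => W n.2) atTop (𝓝 0) := by
        rw [← prod_atTop_atTop_eq]
        exact hφ.comp tendsto_snd
      have t3 := (ENNReal.Tendsto.const_mul (a := 2) t1 (by simp)).add
        (ENNReal.Tendsto.const_mul (a := 2) t2 (by simp))
      have t4 := ENNReal.Tendsto.const_mul (a := gaussianMoment 2)
        (((ENNReal.continuous_rpow_const (y := (1 / 2 : ℝ))).tendsto _).comp t3)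
        (Or.inr (gaussianMoment_ne_top (by simp)))
      simpa using t4
    refine tendsto_of_tendsto_of_tendsto_of_le_of_le tendsto_const_nhds h2
      (fun _ => zero_le) fun n => ?_
    refine le_trans (le_of_eq (eLpNorm_congr_ae ?_)) (hW n.1 n.2)
    filter_upwards [(hm n.1).coeFn_toLp, (hm n.2).coeFn_toLp] with ω h1 h2
    simp [h1, h2]
  obtain ⟨Y, hY⟩ := cauchySeq_tendsto_of_complete hcauchy
  refine ⟨Y, hg, Lp.memLp Y, φ, ?_, ?_⟩
  · refine hφ.congr fun n => ?_
    exact (walshNormSq_eq_walshForm hf.measurable ((φ n).continuous.measurable.sub hg)).symm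
  · rw [Lp.tendsto_Lp_iff_tendsto_eLpNorm'] at hY
    refine hY.congr fun n => eLpNorm_congr_ae ?_
    filter_upwards [(hm n).coeFn_toLp] with ω h1
    simp [h1]

/-- All moments of the difference of two stochastic integrals are controlled by the norm of the
difference of the integrands. -/
lemma IsSpatialGaussianNoise.eLpNorm_integral_sub_le (hF : IsSpatialGaussianNoise P f F)
    (hf : IsNoiseKernel f) {g g' : ℝ × Plane → ℝ} {Y Y' : Ω → ℝ}
    (hY : IsStochIntegral P f F g Y) (hY' : IsStochIntegral P f F g' Y') {p : ℝ≥0∞}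
    (hp : p ≠ ∞) :
    eLpNorm (fun ω => Y ω - Y' ω) p P ≤ gaussianMoment p *
      (2 * walshForm f (fun q => g q - g' q) (fun q => g q - g' q)) ^ (1 / 2 : ℝ) := by
  have hpos := hF.isPositiveOnTestFn hf
  have hg := hY.measurable_integrand
  have hg' := hY'.measurable_integrand
  obtain ⟨φ, hφ, hφY⟩ := hY.exists_approx
  obtain ⟨ψ, hψ, hψY⟩ := hY'.exists_approx
  set w := walshForm f (fun q => g q - g' q) (fun q => g q - g' q)
  set A : ℕ → ℝ≥0∞ := fun n => walshNormSq f fun q => φ n q - g q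
  set B : ℕ → ℝ≥0∞ := fun n => walshNormSq f fun q => ψ n q - g' q
  have hA : ∀ n, A n = walshForm f (fun q => φ n q - g q) (fun q => φ n q - g q) := fun n =>
    walshNormSq_eq_walshForm hf.measurable ((φ n).continuous.measurable.sub hg)
  have hB : ∀ n, B n = walshForm f (fun q => ψ n q - g' q) (fun q => ψ n q - g' q) := fun n =>
    walshNormSq_eq_walshForm hf.measurable ((ψ n).continuous.measurable.sub hg')
  have hbound : ∀ n, eLpNorm (fun ω => F (φ n) ω - F (ψ n) ω) p P ≤
      gaussianMoment p * (2 * w + 2 * (2 * A n + 2 * B n)) ^ (1 / 2 : ℝ) := by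
    intro n
    refine (hF.eLpNorm_increment_le hf _ _ p).trans ?_
    have mφ := (φ n).continuous.measurable
    have mψ := (ψ n).continuous.measurable
    have h1 := hf.walshForm_add_le hpos (g := fun q => g q - g' q)
      (h := fun q => (φ n q - g q) + (g' q - ψ n q)) (hg.sub hg')
      ((mφ.sub hg).add (hg'.sub mψ))
    have h2 := hf.walshForm_add_le hpos (g := fun q => φ n q - g q)
      (h := fun q => g' q - ψ n q) (mφ.sub hg) (hg'.sub mψ)
    rw [walshForm_sub_comm g', ← hA, ← hB] at h2
    have h3 : (fun q => g q - g' q + ((φ n q - g q) + (g' q - ψ n q))) =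
        fun q => φ n q - ψ n q := by
      ext q
      ring
    rw [h3] at h1
    gcongr
    exact h1.trans (by gcongr)
  have hmφ : ∀ n, MemLp (F (φ n)) 2 P := fun n => hF.memLp (φ n) (by simp)
  have hmψ : ∀ n, MemLp (F (ψ n)) 2 P := fun n => hF.memLp (ψ n) (by simp)
  have hconv : TendstoInMeasure P (fun n => F (φ n) - F (ψ n)) atTop (Y - Y') := by
    refine tendstoInMeasure_of_tendsto_eLpNorm (p := 2) (by simp)
      (fun n => ((hmφ n).sub (hmψ n)).1) (hY.memLp.sub hY'.memLp).1 ?_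
    refine tendsto_of_tendsto_of_tendsto_of_le_of_le tendsto_const_nhds
      (by simpa using hφY.add hψY) (fun _ => zero_le) fun n => ?_
    have : F (φ n) - F (ψ n) - (Y - Y') = (F (φ n) - Y) - (F (ψ n) - Y') := by
      ext ω
      simp only [Pi.sub_apply]
      ring
    rw [this]
    exact eLpNorm_sub_le ((hmφ n).sub hY.memLp).1 ((hmψ n).sub hY'.memLp).1 (by norm_num)
  obtain ⟨ns, hns, hae⟩ := hconv.exists_seq_tendsto_ae
  refine (Lp.eLpNorm_lim_le_liminf_eLpNorm (fun n => ((hmφ (ns n)).sub (hmψ (ns n))).1) _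
    hae).trans ?_
  refine (liminf_le_liminf (Eventually.of_forall fun n => hbound (ns n))).trans ?_
  have t3 : Tendsto (fun n => 2 * w + 2 * (2 * A n + 2 * B n)) atTop (𝓝 (2 * w)) := by
    have := tendsto_const_nhds (x := 2 * w) (f := (atTop : Filter ℕ)) |>.add
      (ENNReal.Tendsto.const_mul (a := 2) ((ENNReal.Tendsto.const_mul (a := 2) hφ
      (by simp)).add (ENNReal.Tendsto.const_mul (a := 2) hψ (by simp))) (by simp))
    simpa using this
  have t4 := ENNReal.Tendsto.const_mul (a := gaussianMoment p)
    (((ENNReal.continuous_rpow_const (y := (1 / 2 : ℝ))).tendsto _).comp t3)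
    (Or.inr (gaussianMoment_ne_top hp))
  exact ((t4.comp hns.tendsto_atTop).liminf_eq).le

end Noise

section SingularIntegrals

lemma lintegral_Ioo_rpow_neg_lt_top {β : ℝ} (hβ : β < 1) (T : ℝ) :
    ∫⁻ r in Ioo (0 : ℝ) T, ENNReal.ofReal r ^ (-β) < ∞ := by
  rcases le_or_gt T 0 with hT | hT
  · simp [Ioo_eq_empty (not_lt.2 hT)]
  have h1 : IntegrableOn (fun r : ℝ => r ^ (-β)) (Ioo 0 T) := by
    have := intervalIntegral.intervalIntegrable_rpow' (a := 0) (b := T) (r := -β) (by linarith)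
    rw [intervalIntegrable_iff_integrableOn_Ioo_of_le hT.le] at this
    exact this
  refine lt_of_le_of_lt (le_of_eq ?_) h1.hasFiniteIntegral
  refine setLIntegral_congr_fun measurableSet_Ioo fun r hr => ?_
  simp only
  rw [ENNReal.ofReal_rpow_of_pos hr.1, Real.enorm_of_nonneg (Real.rpow_nonneg hr.1.le _)]

lemma lintegral_closedBall_norm_rpow_neg_lt_top {β : ℝ} (hβ : β < 2) (T : ℝ) :
    ∫⁻ y in Metric.closedBall (0 : Plane) T, ‖y‖ₑ ^ (-β) < ∞ := by
  have h1 : IntegrableOn (fun y : Plane => ‖y‖ ^ (-β)) (Metric.ball 0 (|T| + 1)) := by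
    refine (integrableOn_fun_norm_addHaar volume (f := fun r : ℝ => r ^ (-β))).2 ?_
    have := intervalIntegral.intervalIntegrable_rpow' (a := 0) (b := |T| + 1) (r := 1 - β)
      (by linarith)
    rw [intervalIntegrable_iff_integrableOn_Ioo_of_le (by positivity)] at this
    refine this.congr_fun (fun r hr => ?_) measurableSet_Ioo
    simp only [finrank_euclideanSpace, Fintype.card_fin, smul_eq_mul]
    rw [show 1 - β = 1 + -β by ring, Real.rpow_add hr.1, Real.rpow_one]
    norm_num
  refine lt_of_le_of_lt (lintegral_mono_set (t := Metric.ball 0 (|T| + 1)) ?_)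
    (lt_of_le_of_lt (le_of_eq ?_) h1.hasFiniteIntegral)
  · exact Metric.closedBall_subset_ball (by linarith [le_abs_self T])
  · refine lintegral_congr_ae ?_
    have : ∀ᵐ y : Plane ∂volume.restrict (Metric.ball 0 (|T| + 1)), y ≠ 0 :=
      ae_restrict_of_ae (by simp [ae_iff])
    filter_upwards [this] with y hy
    rw [← ofReal_norm, ENNReal.ofReal_rpow_of_pos (norm_pos_iff.2 hy),
      Real.enorm_of_nonneg (Real.rpow_nonneg (norm_nonneg _) _)]

lemma lintegral_ball_abs_rpow_neg_lt_top {α : ℝ} (hα : α < 1) :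
    ∫⁻ y in Ioo (-1 : ℝ) 1, ‖y‖ₑ ^ (-α) < ∞ := by
  have h2 := lintegral_Ioo_rpow_neg_lt_top hα 1
  have h0 : ∀ᵐ y : ℝ, y ≠ 0 := by simp [ae_iff]
  have hsub : ∫⁻ y in Ioo (-1 : ℝ) 1, ‖y‖ₑ ^ (-α) ≤
      (∫⁻ y in Ioo (-1 : ℝ) 0, ‖y‖ₑ ^ (-α)) + ∫⁻ y in Ioo (0 : ℝ) 1, ‖y‖ₑ ^ (-α) := by
    refine le_trans (le_of_eq (setLIntegral_congr ?_)) (lintegral_union_le _ _ _)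
    filter_upwards [h0] with y hy
    refine propext ⟨fun h => ?_, fun h => ?_⟩
    · rcases lt_or_gt_of_ne hy with h' | h'
      · exact Or.inl ⟨h.1, h'⟩
      · exact Or.inr ⟨h', h.2⟩
    · rcases h with h | h
      · exact ⟨h.1, h.2.trans one_pos⟩
      · exact ⟨lt_trans (by norm_num) h.1, h.2⟩
  have hpos : ∫⁻ y in Ioo (0 : ℝ) 1, ‖y‖ₑ ^ (-α) = ∫⁻ r in Ioo (0 : ℝ) 1, ENNReal.ofReal r ^ (-α) :=
    setLIntegral_congr_fun measurableSet_Ioo fun y hy => by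
      rw [Real.enorm_of_nonneg hy.1.le]
  have hneg : ∫⁻ y in Ioo (-1 : ℝ) 0, ‖y‖ₑ ^ (-α) = ∫⁻ y in Ioo (0 : ℝ) 1, ‖y‖ₑ ^ (-α) := by
    rw [← lintegral_indicator measurableSet_Ioo, ← lintegral_indicator measurableSet_Ioo,
      ← lintegral_neg_eq_self]
    refine lintegral_congr fun y => ?_
    simp only [indicator, mem_Ioo, enorm_neg]
    congr 1
    refine propext ⟨fun h => ⟨by linarith [h.2], by linarith [h.1]⟩,
      fun h => ⟨by linarith [h.2], by linarith [h.1]⟩⟩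
  rw [hneg, hpos] at hsub
  exact hsub.trans_lt (ENNReal.add_lt_top.2 ⟨h2, h2⟩)

/-- Integrals of a translated power singularity over an interval are bounded uniformly in the
translation. -/
lemma exists_lintegral_Icc_affine_rpow_neg_le {α : ℝ} (hα0 : 0 < α) (hα : α < 1) (T : ℝ) :
    ∃ C : ℝ≥0∞, C ≠ ∞ ∧ ∀ a c : ℝ, a ≠ 0 →
      ∫⁻ y in Icc (-T) T, ‖a * y + c‖ₑ ^ (-α) ≤ ‖a‖ₑ ^ (-α) * C := by
  refine ⟨volume (Icc (-T) T) + ∫⁻ y in Ioo (-1 : ℝ) 1, ‖y‖ₑ ^ (-α),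
    ENNReal.add_ne_top.2 ⟨measure_Icc_lt_top.ne, (lintegral_ball_abs_rpow_neg_lt_top hα).ne⟩, ?_⟩
  intro a c ha
  have h1 : ∀ y : ℝ, ‖a * y + c‖ₑ ^ (-α) = ‖a‖ₑ ^ (-α) * ‖y + c / a‖ₑ ^ (-α) := by
    intro y
    rw [← ENNReal.mul_rpow_of_ne_top (by simp) (by simp), ← enorm_mul]
    congr 2
    field_simp
  simp_rw [h1]
  rw [lintegral_const_mul _ (by fun_prop)]
  gcongr
  have h2 : ∀ y : ℝ, ‖y + c / a‖ₑ ^ (-α) ≤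
      1 + (Ioo (-1 : ℝ) 1).indicator (fun y => ‖y‖ₑ ^ (-α)) (y + c / a) := by
    intro y
    by_cases hy : y + c / a ∈ Ioo (-1 : ℝ) 1
    · rw [indicator_of_mem hy]
      exact le_add_self
    · rw [indicator_of_notMem hy, add_zero]
      have : 1 ≤ ‖y + c / a‖ₑ := by
        have h3 : 1 ≤ |y + c / a| := by
          by_contra! h
          exact hy (abs_lt.1 h)
        rw [← ofReal_norm, Real.norm_eq_abs]
        simpa using ENNReal.ofReal_le_ofReal h3
      exact ENNReal.rpow_le_one_of_one_le_of_neg this (by linarith)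
  calc ∫⁻ y in Icc (-T) T, ‖y + c / a‖ₑ ^ (-α)
      ≤ ∫⁻ y in Icc (-T) T, (1 + (Ioo (-1 : ℝ) 1).indicator (fun y => ‖y‖ₑ ^ (-α)) (y + c / a)) :=
        lintegral_mono h2
    _ = volume (Icc (-T) T) + ∫⁻ y in Icc (-T) T,
          (Ioo (-1 : ℝ) 1).indicator (fun y => ‖y‖ₑ ^ (-α)) (y + c / a) := by
        rw [lintegral_add_left measurable_const]
        simp
    _ ≤ _ := by
        refine add_le_add le_rfl ?_
        refine (setLIntegral_le_lintegral _ _).trans (le_of_eq ?_)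
        rw [lintegral_add_right_eq_self
          (fun y => (Ioo (-1 : ℝ) 1).indicator (fun y : ℝ => ‖y‖ₑ ^ (-α)) y),
          lintegral_indicator measurableSet_Ioo]

lemma lintegral_plane_eq (h : ℝ × ℝ → ℝ≥0∞) :
    ∫⁻ y : Plane, h (y 0, y 1) = ∫⁻ p : ℝ × ℝ, h p := by
  have h1 := (EuclideanSpace.volume_preserving_symm_measurableEquiv_toLp (Fin 2)).symm
  have h2 := volume_preserving_finTwoArrow ℝ
  rw [← h2.lintegral_comp_emb (MeasurableEquiv.measurableEmbedding _),
    ← h1.lintegral_comp_emb (MeasurableEquiv.measurableEmbedding _)]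
  rfl

/-- Integrals over a disc of a power singularity along a line. -/
lemma exists_lintegral_closedBall_line_rpow_neg_le {α : ℝ} (hα0 : 0 < α) (hα : α < 1) (T : ℝ) :
    ∃ C : ℝ≥0∞, C ≠ ∞ ∧ ∀ w : Plane, w ≠ 0 →
      ∫⁻ y in Metric.closedBall (0 : Plane) T, ‖‖y‖ ^ 2 - ‖y - w‖ ^ 2‖ₑ ^ (-α) ≤
        C * ‖w‖ₑ ^ (-α) := by
  obtain ⟨C, hC, hC'⟩ := exists_lintegral_Icc_affine_rpow_neg_le hα0 hα T
  refine ⟨volume (Icc (-T) T) * C, ENNReal.mul_ne_top measure_Icc_lt_top.ne hC, fun w hw => ?_⟩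
  have hnorm : ∀ y : Plane, ‖y‖ ^ 2 = y 0 ^ 2 + y 1 ^ 2 := fun y => by
    rw [EuclideanSpace.norm_sq_eq]
    simp
  set c : ℝ := -(w 0 ^ 2 + w 1 ^ 2)
  have hdiff : ∀ y : Plane, ‖y‖ ^ 2 - ‖y - w‖ ^ 2 = 2 * w 0 * y 0 + (2 * w 1 * y 1 + c) := by
    intro y
    rw [hnorm, hnorm]
    simp only [PiLp.sub_apply, c]
    ring
  let H : ℝ × ℝ → ℝ≥0∞ := fun p => (Icc (-T) T ×ˢ Icc (-T) T).indicator
    (fun p => ‖2 * w 0 * p.1 + (2 * w 1 * p.2 + c)‖ₑ ^ (-α)) p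
  have hHm : Measurable H :=
    Measurable.indicator (by fun_prop) (measurableSet_Icc.prod measurableSet_Icc)
  have h1 : ∫⁻ y in Metric.closedBall (0 : Plane) T, ‖‖y‖ ^ 2 - ‖y - w‖ ^ 2‖ₑ ^ (-α) ≤
      ∫⁻ p, H p := by
    rw [← lintegral_plane_eq, ← lintegral_indicator Metric.isClosed_closedBall.measurableSet]
    refine lintegral_mono fun y => ?_
    by_cases hy : y ∈ Metric.closedBall (0 : Plane) T
    · have hc : ∀ i, y i ∈ Icc (-T) T := fun i => by
        rw [mem_closedBall_zero_iff] at hy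
        exact abs_le.1 ((PiLp.norm_apply_le y i).trans hy)
      have : (y 0, y 1) ∈ Icc (-T) T ×ˢ Icc (-T) T := ⟨hc 0, hc 1⟩
      simp only [H]
      rw [indicator_of_mem hy, indicator_of_mem this, hdiff]
    · rw [indicator_of_notMem hy]
      exact zero_le
  have hind : ∀ a b, H (a, b) = (Icc (-T) T).indicator (fun a => (Icc (-T) T).indicator
      (fun b => ‖2 * w 0 * a + (2 * w 1 * b + c)‖ₑ ^ (-α)) b) a := by
    intro a b
    simp only [H, indicator, mem_prod]
    split_ifs <;> tauto
  have hind' : ∀ a b, H (a, b) = (Icc (-T) T).indicator (fun b => (Icc (-T) T).indicator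
      (fun a => ‖2 * w 0 * a + (2 * w 1 * b + c)‖ₑ ^ (-α)) a) b := by
    intro a b
    simp only [H, indicator, mem_prod]
    split_ifs <;> tauto
  have hcoord : ‖w‖ ≤ |2 * w 0| ∨ ‖w‖ ≤ |2 * w 1| := by
    by_contra! h
    have e0 := sq_lt_sq' (by linarith [abs_nonneg (2 * w 0), norm_nonneg w]) h.1
    have e1 := sq_lt_sq' (by linarith [abs_nonneg (2 * w 1), norm_nonneg w]) h.2
    rw [sq_abs, hnorm] at e0 e1
    nlinarith [sq_nonneg (w 0), sq_nonneg (w 1)]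
  have hne : ∀ a : ℝ, ‖w‖ ≤ |a| → a ≠ 0 ∧ ‖a‖ₑ ^ (-α) ≤ ‖w‖ₑ ^ (-α) := by
    intro a ha
    refine ⟨fun h => ?_, ?_⟩
    · rw [h, abs_zero] at ha
      exact hw (norm_le_zero_iff.1 ha)
    · rw [ENNReal.rpow_neg, ENNReal.rpow_neg, ENNReal.inv_le_inv]
      exact ENNReal.rpow_le_rpow (enorm_le_iff_norm_le.2 ha) hα0.le
  refine h1.trans ?_
  rw [Measure.volume_eq_prod]
  rcases hcoord with h | h
  · obtain ⟨h2, h3⟩ := hne _ h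
    rw [lintegral_prod_symm _ hHm.aemeasurable]
    simp only [hind']
    calc _ = ∫⁻ b in Icc (-T) T, ∫⁻ a in Icc (-T) T,
            ‖2 * w 0 * a + (2 * w 1 * b + c)‖ₑ ^ (-α) := by
          rw [← lintegral_indicator measurableSet_Icc]
          refine lintegral_congr fun b => ?_
          by_cases hb : b ∈ Icc (-T) T
          · simp only [indicator_of_mem hb]
            rw [lintegral_indicator measurableSet_Icc]
          · simp [indicator_of_notMem hb]
      _ ≤ ∫⁻ b in Icc (-T) T, ‖w‖ₑ ^ (-α) * C :=
          lintegral_mono fun b => (hC' _ _ h2).trans (mul_le_mul_left h3 _)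
      _ = _ := by
          rw [setLIntegral_const]
          ring
  · obtain ⟨h2, h3⟩ := hne _ h
    rw [lintegral_prod _ hHm.aemeasurable]
    simp only [hind]
    calc _ = ∫⁻ a in Icc (-T) T, ∫⁻ b in Icc (-T) T,
            ‖2 * w 1 * b + (2 * w 0 * a + c)‖ₑ ^ (-α) := by
          rw [← lintegral_indicator measurableSet_Icc]
          refine lintegral_congr fun a => ?_
          by_cases ha : a ∈ Icc (-T) T
          · simp only [indicator_of_mem ha]
            rw [lintegral_indicator measurableSet_Icc]
            refine lintegral_congr fun b => ?_
            congr 2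
            ring
          · simp [indicator_of_notMem ha]
      _ ≤ ∫⁻ a in Icc (-T) T, ‖w‖ₑ ^ (-α) * C :=
          lintegral_mono fun b => (hC' _ _ h2).trans (mul_le_mul_left h3 _)
      _ = _ := by
          rw [setLIntegral_const]
          ring

end SingularIntegrals

/-- `r₊² - ‖v‖²`, which is positive exactly in the open forward light cone. -/
noncomputable def coneExcess (r : ℝ) (v : Plane) : ℝ := max r 0 ^ 2 - ‖v‖ ^ 2

/-- The power `(r² - ‖v‖²)^(-γ)` inside the forward light cone, and `0` outside. -/
noncomputable def conePower (γ r : ℝ) (v : Plane) : ℝ := max (coneExcess r v) 0 ^ (-γ)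

/-- The base point `x - m (t - s) e₁` of the backward light cone of `(t, x)` at time `s`. -/
noncomputable def driftCentre (m t : ℝ) (x : Plane) (s : ℝ) : Plane :=
  x - (m * (t - s)) • EuclideanSpace.single 0 1

section ConePower

lemma measurable_conePower (γ : ℝ) : Measurable fun p : ℝ × Plane => conePower γ p.1 p.2 := by
  unfold conePower coneExcess
  fun_prop

lemma conePower_nonneg (γ r : ℝ) (v : Plane) : 0 ≤ conePower γ r v :=
  Real.rpow_nonneg (le_max_right _ _) _

lemma conePower_eq_zero {γ r : ℝ} {v : Plane} (hγ : 0 < γ) (h : r ≤ ‖v‖) :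
    conePower γ r v = 0 := by
  have : coneExcess r v ≤ 0 := by
    have h1 : max r 0 ≤ ‖v‖ := max_le h (norm_nonneg v)
    have := pow_le_pow_left₀ (le_max_right r 0) h1 2
    rw [coneExcess]
    linarith
  rw [conePower, max_eq_right this, Real.zero_rpow (by linarith)]

lemma conePower_of_lt {γ r : ℝ} {v : Plane} (h : ‖v‖ < r) :
    conePower γ r v = (r ^ 2 - ‖v‖ ^ 2) ^ (-γ) := by
  have hr : 0 ≤ r := (norm_nonneg v).trans h.le
  have : 0 ≤ r ^ 2 - ‖v‖ ^ 2 := sub_nonneg.2 (pow_le_pow_left₀ (norm_nonneg v) h.le 2)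
  rw [conePower, coneExcess, max_eq_left hr, max_eq_left this]

lemma rpow_neg_mul_rpow_neg_le {a b γ σ : ℝ} (hb : 0 < b) (hab : b < a) (hσ0 : 0 ≤ σ)
    (hσ : σ ≤ γ) : a ^ (-γ) * b ^ (-γ) ≤ (a - b) ^ (-σ) * b ^ (-(2 * γ - σ)) := by
  have ha : 0 < a := hb.trans hab
  have h1 : a ^ (-γ) = a ^ (-σ) * a ^ (-(γ - σ)) := by
    rw [← Real.rpow_add ha]
    congr 1
    ring
  have h2 : b ^ (-(2 * γ - σ)) = b ^ (-(γ - σ)) * b ^ (-γ) := by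
    rw [← Real.rpow_add hb]
    congr 1
    ring
  rw [h1, h2, ← mul_assoc]
  gcongr ?_ * ?_ * _
  · exact Real.rpow_le_rpow_of_nonpos (by linarith) (by linarith) (by linarith)
  · exact Real.rpow_le_rpow_of_nonpos hb hab.le (by linarith)

lemma conePower_mul_conePower_le {γ σ r : ℝ} {y z : Plane} (hσ0 : 0 ≤ σ) (hσ : σ ≤ γ)
    (hy : y ≠ 0) (hyz : ‖y‖ ≠ ‖z‖) (hr : max ‖y‖ ‖z‖ < r) :
    conePower γ r y * conePower γ r z ≤ |‖y‖ ^ 2 - ‖z‖ ^ 2| ^ (-σ) *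
      (‖y‖ ^ (-(2 * γ - σ)) * (r - max ‖y‖ ‖z‖) ^ (-(2 * γ - σ))) := by
  have hy0 : 0 < ‖y‖ := norm_pos_iff.2 hy
  have hz0 : 0 ≤ ‖z‖ := norm_nonneg z
  obtain ⟨hry, hrz⟩ := max_lt_iff.1 hr
  rw [conePower_of_lt hry, conePower_of_lt hrz]
  rcases lt_or_gt_of_ne hyz with h | h
  · rw [max_eq_right h.le] at hr ⊢
    have hsq : ‖y‖ ^ 2 < ‖z‖ ^ 2 := by gcongr
    have hb : 0 < r ^ 2 - ‖z‖ ^ 2 := by nlinarith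
    refine (rpow_neg_mul_rpow_neg_le hb (by linarith) hσ0 hσ).trans ?_
    rw [abs_of_neg (by linarith), ← Real.mul_rpow hy0.le (by linarith)]
    have e : r ^ 2 - ‖y‖ ^ 2 - (r ^ 2 - ‖z‖ ^ 2) = -(‖y‖ ^ 2 - ‖z‖ ^ 2) := by ring
    rw [e]
    refine mul_le_mul_of_nonneg_left ?_ (Real.rpow_nonneg (by linarith) _)
    exact Real.rpow_le_rpow_of_nonpos (mul_pos hy0 (by linarith)) (by nlinarith) (by linarith)
  · rw [max_eq_left h.le] at hr ⊢
    have hsq : ‖z‖ ^ 2 < ‖y‖ ^ 2 := by gcongr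
    have hb : 0 < r ^ 2 - ‖y‖ ^ 2 := by nlinarith
    rw [mul_comm]
    refine (rpow_neg_mul_rpow_neg_le hb (by linarith) hσ0 hσ).trans ?_
    rw [abs_of_pos (by linarith), ← Real.mul_rpow hy0.le (by linarith)]
    have e : r ^ 2 - ‖z‖ ^ 2 - (r ^ 2 - ‖y‖ ^ 2) = ‖y‖ ^ 2 - ‖z‖ ^ 2 := by ring
    rw [e]
    refine mul_le_mul_of_nonneg_left ?_ (Real.rpow_nonneg (by linarith) _)
    exact Real.rpow_le_rpow_of_nonpos (mul_pos hy0 (by linarith)) (by nlinarith) (by linarith)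

lemma ENNReal.mul_le_sq_add_sq (a b : ℝ≥0∞) : a * b ≤ a * a + b * b := by
  rcases le_total a b with h | h
  · exact (mul_le_mul_left h b).trans le_add_self
  · exact (mul_le_mul_right h a).trans le_self_add

/-- The time integral of the product of two cone powers. -/
lemma exists_lintegral_conePower_mul_le {γ σ : ℝ} (hσ0 : 0 < σ) (hσ : σ ≤ γ)
    (hβ : 2 * γ - σ < 1) (T : ℝ) :
    ∃ C : ℝ≥0∞, C ≠ ∞ ∧ ∀ y z : Plane,
      ∫⁻ r in Ioo (0 : ℝ) T, ‖conePower γ r y‖ₑ * ‖conePower γ r z‖ₑ ≤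
        C * (‖‖y‖ ^ 2 - ‖z‖ ^ 2‖ₑ ^ (-(2 * σ)) + ‖y‖ₑ ^ (-(2 * (2 * γ - σ)))) := by
  set β := 2 * γ - σ
  have hβ0 : 0 < β := by linarith
  set C₀ := ∫⁻ r in Ioo (0 : ℝ) T, ENNReal.ofReal r ^ (-β)
  have hC₀ : C₀ < ∞ := lintegral_Ioo_rpow_neg_lt_top hβ T
  refine ⟨C₀ + 1, by simp [hC₀.ne], fun y z => ?_⟩
  by_cases hy : y = 0
  · simp [hy, ENNReal.zero_rpow_of_neg (show -(2 * β) < 0 by linarith), ENNReal.mul_top]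
  by_cases hyz : ‖y‖ = ‖z‖
  · simp [hyz, ENNReal.zero_rpow_of_neg (show -(2 * σ) < 0 by linarith), ENNReal.mul_top]
  set M := max ‖y‖ ‖z‖
  have hM0 : 0 ≤ M := (norm_nonneg y).trans (le_max_left _ _)
  set D := ‖‖y‖ ^ 2 - ‖z‖ ^ 2‖ₑ
  have hy0 : 0 < ‖y‖ := norm_pos_iff.2 hy
  have hD0 : 0 < |‖y‖ ^ 2 - ‖z‖ ^ 2| := by
    refine abs_pos.2 fun h => hyz ?_
    exact (pow_left_inj₀ (norm_nonneg y) (norm_nonneg z) two_ne_zero).1 (sub_eq_zero.1 h)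
  have hpt : ∀ r ∈ Ioo (0 : ℝ) T, ‖conePower γ r y‖ₑ * ‖conePower γ r z‖ₑ ≤
      (D ^ (-σ) * ‖y‖ₑ ^ (-β)) *
        (Ioo (0 : ℝ) T).indicator (fun r => ENNReal.ofReal r ^ (-β)) (r - M) := by
    intro r hr
    rcases le_or_gt r M with h | h
    · have : conePower γ r y = 0 ∨ conePower γ r z = 0 := by
        rcases le_max_iff.1 h with h | h
        · exact Or.inl (conePower_eq_zero (by linarith) h)
        · exact Or.inr (conePower_eq_zero (by linarith) h)
      rcases this with h | h <;> simp [h]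
    · have hmem : r - M ∈ Ioo (0 : ℝ) T := ⟨by linarith, by linarith [hr.2]⟩
      rw [indicator_of_mem hmem, ← enorm_mul, Real.enorm_of_nonneg
        (mul_nonneg (conePower_nonneg _ _ _) (conePower_nonneg _ _ _))]
      refine (ENNReal.ofReal_le_ofReal (conePower_mul_conePower_le hσ0.le hσ hy hyz
        h)).trans (le_of_eq ?_)
      rw [ENNReal.ofReal_mul (Real.rpow_nonneg hD0.le _),
        ENNReal.ofReal_mul (Real.rpow_nonneg hy0.le _), ← ENNReal.ofReal_rpow_of_pos hD0,
        ← ENNReal.ofReal_rpow_of_pos hy0, ← ENNReal.ofReal_rpow_of_pos hmem.1, mul_assoc,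
        ← Real.norm_eq_abs, ofReal_norm, ofReal_norm]
  calc ∫⁻ r in Ioo (0 : ℝ) T, ‖conePower γ r y‖ₑ * ‖conePower γ r z‖ₑ
      ≤ ∫⁻ r in Ioo (0 : ℝ) T, (D ^ (-σ) * ‖y‖ₑ ^ (-β)) *
        (Ioo (0 : ℝ) T).indicator (fun r => ENNReal.ofReal r ^ (-β)) (r - M) :=
        setLIntegral_mono' measurableSet_Ioo hpt
    _ ≤ ∫⁻ r, (D ^ (-σ) * ‖y‖ₑ ^ (-β)) *
        (Ioo (0 : ℝ) T).indicator (fun r => ENNReal.ofReal r ^ (-β)) (r - M) :=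
        setLIntegral_le_lintegral _ _
    _ = (D ^ (-σ) * ‖y‖ₑ ^ (-β)) * C₀ := by
        have hm : Measurable ((Ioo (0 : ℝ) T).indicator fun r => ENNReal.ofReal r ^ (-β)) :=
          Measurable.indicator (by fun_prop) measurableSet_Ioo
        have hm' : Measurable fun r : ℝ =>
            (Ioo (0 : ℝ) T).indicator (fun r => ENNReal.ofReal r ^ (-β)) (r - M) :=
          hm.comp (by fun_prop)
        rw [lintegral_const_mul _ hm', lintegral_sub_right_eq_self
          (fun r => (Ioo (0 : ℝ) T).indicator (fun r => ENNReal.ofReal r ^ (-β)) r),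
          lintegral_indicator measurableSet_Ioo]
    _ ≤ (D ^ (-(2 * σ)) + ‖y‖ₑ ^ (-(2 * β))) * (C₀ + 1) := by
        gcongr
        · refine (ENNReal.mul_le_sq_add_sq _ _).trans (le_of_eq ?_)
          have hDne : D ≠ 0 := by
            simp only [D, ne_eq, enorm_eq_zero]
            exact abs_pos.1 hD0
          rw [← ENNReal.rpow_add _ _ hDne (by simp [D]),
            ← ENNReal.rpow_add _ _ (by simpa using hy) (by simp)]
          congr 2 <;> ring
        · exact le_self_add
    _ = _ := mul_comm _ _

/-- The convolution-type energy of the cone power over a time interval. -/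
lemma lintegral_conePower_energy_lt_top {f : ℝ → ℝ} {γ σ : ℝ} (hf : IsNoiseKernel f)
    (hσ0 : 0 < σ) (hσ : σ ≤ γ) (hβ : 2 * γ - σ < 1) (hσ1 : 2 * σ < 1)
    (hsing : ∀ R : ℝ, ∫⁻ w in Metric.closedBall (0 : Plane) R,
      ENNReal.ofReal (f ‖w‖) * ‖w‖ₑ ^ (-(2 * σ)) < ∞) (T : ℝ) :
    ∫⁻ r in Ioo (0 : ℝ) T, ∫⁻ y : Plane, ∫⁻ z : Plane,
      ‖conePower γ r y‖ₑ * ‖conePower γ r z‖ₑ * ENNReal.ofReal (f ‖y - z‖) < ∞ := by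
  obtain ⟨C, hC, hΘ⟩ := exists_lintegral_conePower_mul_le hσ0 hσ hβ T
  obtain ⟨C', hC', hline⟩ := exists_lintegral_closedBall_line_rpow_neg_le
    (α := 2 * σ) (by linarith) hσ1 T
  set A := ∫⁻ y in Metric.closedBall (0 : Plane) T, ‖y‖ₑ ^ (-(2 * (2 * γ - σ)))
  have hA : A < ∞ := lintegral_closedBall_norm_rpow_neg_lt_top (by linarith) T
  have hγ : 0 < γ := by linarith
  have hmc := measurable_conePower γ
  have hmy : Measurable fun p : (ℝ × Plane) × Plane => conePower γ p.1.1 p.1.2 :=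
    hmc.comp (by fun_prop)
  have hmz : Measurable fun p : (ℝ × Plane) × Plane => conePower γ p.1.1 p.2 :=
    hmc.comp (f := fun p : (ℝ × Plane) × Plane => (p.1.1, p.2)) (by fun_prop)
  have hmf : Measurable fun w : Plane => ENNReal.ofReal (f ‖w‖) :=
    (hf.measurable.comp measurable_norm).ennreal_ofReal
  let Θ : Plane → Plane → ℝ≥0∞ := fun y z =>
    ∫⁻ r in Ioo (0 : ℝ) T, ‖conePower γ r y‖ₑ * ‖conePower γ r z‖ₑ
  have hΘm : Measurable fun p : Plane × Plane => Θ p.1 p.2 := by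
    refine Measurable.lintegral_prod_right' (f := fun q : (Plane × Plane) × ℝ =>
      ‖conePower γ q.2 q.1.1‖ₑ * ‖conePower γ q.2 q.1.2‖ₑ) ?_
    have h1 : Measurable fun q : (Plane × Plane) × ℝ => conePower γ q.2 q.1.1 :=
      hmc.comp (f := fun q : (Plane × Plane) × ℝ => (q.2, q.1.1)) (by fun_prop)
    have h2 : Measurable fun q : (Plane × Plane) × ℝ => conePower γ q.2 q.1.2 :=
      hmc.comp (f := fun q : (Plane × Plane) × ℝ => (q.2, q.1.2)) (by fun_prop)
    fun_prop
  have hΘ0 : ∀ y z, ¬(‖y‖ ≤ T ∧ ‖z‖ ≤ T) → Θ y z = 0 := by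
    intro y z h
    refine (setLIntegral_congr_fun (g := fun _ => 0) measurableSet_Ioo fun r hr => ?_).trans
      (by simp)
    have : conePower γ r y = 0 ∨ conePower γ r z = 0 := by
      by_contra! h'
      refine h ⟨?_, ?_⟩
      · by_contra! h2
        exact h'.1 (conePower_eq_zero hγ (hr.2.le.trans h2.le))
      · by_contra! h2
        exact h'.2 (conePower_eq_zero hγ (hr.2.le.trans h2.le))
    rcases this with h | h <;> simp [h]
  have hswap : ∫⁻ r in Ioo (0 : ℝ) T, ∫⁻ y : Plane, ∫⁻ z : Plane,
      ‖conePower γ r y‖ₑ * ‖conePower γ r z‖ₑ * ENNReal.ofReal (f ‖y - z‖) =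
      ∫⁻ y : Plane, ∫⁻ z : Plane, Θ y z * ENNReal.ofReal (f ‖y - z‖) := by
    have hm3 : Measurable fun p : (ℝ × Plane) × Plane =>
        ‖conePower γ p.1.1 p.1.2‖ₑ * ‖conePower γ p.1.1 p.2‖ₑ *
          ENNReal.ofReal (f ‖p.1.2 - p.2‖) :=
      (hmy.enorm.mul hmz.enorm).mul (hmf.comp (f := fun p : (ℝ × Plane) × Plane => p.1.2 - p.2)
        (by fun_prop))
    rw [lintegral_lintegral_swap (by
      simpa only [Function.uncurry_def] using hm3.lintegral_prod_right'.aemeasurable)]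
    refine lintegral_congr fun y => ?_
    rw [lintegral_lintegral_swap (by
      refine Measurable.aemeasurable ?_
      simp only [Function.uncurry_def]
      exact hm3.comp (f := fun p : ℝ × Plane => ((p.1, y), p.2)) (by fun_prop))]
    refine lintegral_congr fun z => ?_
    refine lintegral_mul_const _ ?_
    have h1 : Measurable fun r => conePower γ r y :=
      hmc.comp (f := fun r : ℝ => (r, y)) (by fun_prop)
    have h2 : Measurable fun r => conePower γ r z :=
      hmc.comp (f := fun r : ℝ => (r, z)) (by fun_prop)
    fun_prop
  have hshift : ∫⁻ y : Plane, ∫⁻ z : Plane, Θ y z * ENNReal.ofReal (f ‖y - z‖) =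
      ∫⁻ w : Plane, (∫⁻ y : Plane, Θ y (y - w)) * ENNReal.ofReal (f ‖w‖) := by
    have h1 : ∀ y : Plane, ∫⁻ z : Plane, Θ y z * ENNReal.ofReal (f ‖y - z‖) =
        ∫⁻ w : Plane, Θ y (y - w) * ENNReal.ofReal (f ‖w‖) := by
      intro y
      rw [← lintegral_sub_left_eq_self _ y]
      simp
    simp_rw [h1]
    have hm2 : Measurable fun p : Plane × Plane => Θ p.1 (p.1 - p.2) :=
      hΘm.comp (f := fun p : Plane × Plane => (p.1, p.1 - p.2)) (by fun_prop)
    rw [lintegral_lintegral_swap (by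
      simp only [Function.uncurry_def]
      exact (hm2.mul (hmf.comp measurable_snd)).aemeasurable)]
    refine lintegral_congr fun w => lintegral_mul_const _ ?_
    exact hm2.comp (f := fun y : Plane => (y, w)) (by fun_prop)
  have hin : ∀ w : Plane, w ≠ 0 → (∫⁻ y : Plane, Θ y (y - w)) * ENNReal.ofReal (f ‖w‖) ≤
      (Metric.closedBall (0 : Plane) (2 * T)).indicator (fun w => C * C' *
        (ENNReal.ofReal (f ‖w‖) * ‖w‖ₑ ^ (-(2 * σ))) + C * A * ENNReal.ofReal (f ‖w‖)) w := by
    intro w hw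
    by_cases hwT : w ∈ Metric.closedBall (0 : Plane) (2 * T)
    · rw [indicator_of_mem hwT]
      have h1 : ∫⁻ y : Plane, Θ y (y - w) ≤ C * (C' * ‖w‖ₑ ^ (-(2 * σ)) + A) := by
        calc ∫⁻ y : Plane, Θ y (y - w)
            ≤ ∫⁻ y in Metric.closedBall (0 : Plane) T,
              C * (‖‖y‖ ^ 2 - ‖y - w‖ ^ 2‖ₑ ^ (-(2 * σ)) + ‖y‖ₑ ^ (-(2 * (2 * γ - σ)))) := by
              rw [← lintegral_indicator Metric.isClosed_closedBall.measurableSet]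
              refine lintegral_mono fun y => ?_
              by_cases hy : y ∈ Metric.closedBall (0 : Plane) T
              · rw [indicator_of_mem hy]
                exact hΘ y (y - w)
              · rw [hΘ0 _ _ fun h => hy (by simpa using h.1)]
                exact zero_le
          _ = C * ((∫⁻ y in Metric.closedBall (0 : Plane) T,
              ‖‖y‖ ^ 2 - ‖y - w‖ ^ 2‖ₑ ^ (-(2 * σ))) + A) := by
              rw [lintegral_const_mul _ (by fun_prop), lintegral_add_left (by fun_prop)]
          _ ≤ _ := by
              gcongr
              exact hline w hw
      refine (mul_le_mul_left h1 _).trans (le_of_eq ?_)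
      ring
    · rw [indicator_of_notMem hwT, lintegral_congr (g := fun _ => 0)]
      · simp
      · intro y
        refine hΘ0 _ _ fun h => hwT ?_
        rw [mem_closedBall_zero_iff]
        have := norm_sub_le y (y - w)
        rw [sub_sub_cancel] at this
        linarith
  rw [hswap, hshift]
  calc _ ≤ ∫⁻ w : Plane, (Metric.closedBall (0 : Plane) (2 * T)).indicator (fun w => C * C' *
        (ENNReal.ofReal (f ‖w‖) * ‖w‖ₑ ^ (-(2 * σ))) + C * A * ENNReal.ofReal (f ‖w‖)) w := by
        have : ∀ᵐ w : Plane, w ≠ 0 := by simp [ae_iff]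
        exact lintegral_mono_ae (this.mono hin)
    _ = C * C' * (∫⁻ w in Metric.closedBall (0 : Plane) (2 * T),
          ENNReal.ofReal (f ‖w‖) * ‖w‖ₑ ^ (-(2 * σ)))
        + C * A * ∫⁻ w in Metric.closedBall (0 : Plane) (2 * T), ENNReal.ofReal (f ‖w‖) := by
        rw [lintegral_indicator Metric.isClosed_closedBall.measurableSet,
          lintegral_add_left (by fun_prop), lintegral_const_mul _ (by fun_prop),
          lintegral_const_mul _ hmf]
    _ < ∞ := ENNReal.add_lt_top.2 ⟨ENNReal.mul_lt_top (ENNReal.mul_lt_top hC.lt_top hC'.lt_top)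
        (hsing _), ENNReal.mul_lt_top (ENNReal.mul_lt_top hC.lt_top hA)
        (hf.lintegral_ball_lt_top _)⟩

lemma measurable_conePower_driftCentre (γ m t : ℝ) (x : Plane) :
    Measurable fun p : ℝ × Plane => conePower γ (t - p.1) (driftCentre m t x p.1 - p.2) := by
  refine (measurable_conePower γ).comp
    (f := fun p : ℝ × Plane => (t - p.1, driftCentre m t x p.1 - p.2)) ?_
  unfold driftCentre
  fun_prop

/-- The norm of the cone power based at `(t, x)` does not depend on the base point beyond `t`. -/
lemma walshForm_conePower_le {f : ℝ → ℝ} (hf : IsNoiseKernel f) {γ : ℝ} (hγ : 0 < γ) (m : ℝ)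
    {t T : ℝ} (htT : t ≤ T) (x : Plane) :
    walshForm f (fun p => conePower γ (t - p.1) (driftCentre m t x p.1 - p.2))
      (fun p => conePower γ (t - p.1) (driftCentre m t x p.1 - p.2)) ≤
    ∫⁻ r in Ioo (0 : ℝ) T, ∫⁻ y : Plane, ∫⁻ z : Plane,
      ‖conePower γ r y‖ₑ * ‖conePower γ r z‖ₑ * ENNReal.ofReal (f ‖y - z‖) := by
  have hm := measurable_conePower_driftCentre γ m t x
  set J : ℝ → ℝ≥0∞ := fun r => ∫⁻ y : Plane, ∫⁻ z : Plane,
      ‖conePower γ r y‖ₑ * ‖conePower γ r z‖ₑ * ENNReal.ofReal (f ‖y - z‖) with hJ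
  have hm1 : Measurable fun q : ℝ × Plane × Plane =>
      conePower γ (t - q.1) (driftCentre m t x q.1 - q.2.1) :=
    hm.comp (f := fun q : ℝ × Plane × Plane => (q.1, q.2.1)) (by fun_prop)
  have hm2 : Measurable fun q : ℝ × Plane × Plane =>
      conePower γ (t - q.1) (driftCentre m t x q.1 - q.2.2) :=
    hm.comp (f := fun q : ℝ × Plane × Plane => (q.1, q.2.2)) (by fun_prop)
  rw [walshForm, lintegral_noiseMeasure hf.measurable (by fun_prop)]
  have h1 : ∀ s : ℝ, ∫⁻ y : Plane, ∫⁻ z : Plane,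
      ‖conePower γ (t - s) (driftCentre m t x s - y)‖ₑ *
        ‖conePower γ (t - s) (driftCentre m t x s - z)‖ₑ * ENNReal.ofReal (f ‖y - z‖) =
      J (t - s) := by
    intro s
    set c := driftCentre m t x s
    rw [← lintegral_sub_left_eq_self _ c]
    refine lintegral_congr fun y => ?_
    rw [← lintegral_sub_left_eq_self _ c]
    refine lintegral_congr fun z => ?_
    have : c - y - (c - z) = z - y := by abel
    rw [sub_sub_cancel, sub_sub_cancel, this, norm_sub_rev]
  simp only [h1]
  have hJ0 : ∀ r, r ≤ 0 → J r = 0 := by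
    intro r hr
    have : ∀ y : Plane, conePower γ r y = 0 := fun y =>
      conePower_eq_zero hγ (hr.trans (norm_nonneg y))
    simp [hJ, this]
  rw [← lintegral_indicator measurableSet_Ioi, ← lintegral_indicator measurableSet_Ioo,
    ← lintegral_sub_left_eq_self (fun r => (Ioo (0 : ℝ) T).indicator J r) t]
  refine lintegral_mono fun s => ?_
  by_cases hs : s ∈ Ioi (0 : ℝ)
  · rw [indicator_of_mem hs]
    by_cases hr : t - s ∈ Ioo (0 : ℝ) T
    · rw [indicator_of_mem hr]
    · rw [hJ0]
      · exact zero_le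
      · by_contra! h
        exact hr ⟨h, by linarith [mem_Ioi.1 hs]⟩
  · rw [indicator_of_notMem hs]
    exact zero_le

end ConePower

section GreenFunction

lemma Plane.norm_sq (v : Plane) : ‖v‖ ^ 2 = v 0 ^ 2 + v 1 ^ 2 := by
  rw [EuclideanSpace.norm_sq_eq]
  simp

/-- In the moving frame the Green function is the Green function of the wave operator. -/
lemma greenFn_eq {m r : ℝ} (hm0 : 0 ≤ m) (hm1 : m < 1) (hr : 0 ≤ r) (x : Plane) :
    greenFn m r x = (2 * Real.pi)⁻¹ *
      (√(coneExcess r (x - (m * r) • EuclideanSpace.single 0 1)))⁻¹ := by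
  have hk : 0 < 1 - m ^ 2 := by nlinarith
  set k := 1 - m ^ 2
  set Q := coneExcess r (x - (m * r) • EuclideanSpace.single 0 1) with hQ
  have hQ' : Q = r ^ 2 - ((x 0 - m * r) ^ 2 + x 1 ^ 2) := by
    rw [hQ, coneExcess, max_eq_left hr, Plane.norm_sq]
    simp
  have hrho0 : 0 ≤ machRho m x := Real.sqrt_nonneg _
  have hrho : machRho m x ^ 2 = x 0 ^ 2 / k ^ 2 + x 1 ^ 2 / k := by
    rw [machRho, Real.sq_sqrt (by positivity)]
  have hfac : (r + m * x 0 / k) ^ 2 - machRho m x ^ 2 = Q / k := by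
    rw [hrho, hQ']
    have : m ^ 2 = 1 - k := by simp [k]
    field_simp
    ring_nf
    rw [this]
    ring
  have hle : |m * x 0 / k| ≤ machRho m x := by
    apply Real.abs_le_sqrt
    rw [div_pow]
    have h1 : (m * x 0) ^ 2 / k ^ 2 ≤ x 0 ^ 2 / k ^ 2 := by
      refine div_le_div_of_nonneg_right ?_ (by positivity)
      rw [mul_pow]
      exact mul_le_of_le_one_left (sq_nonneg _) (by nlinarith)
    have h2 : 0 ≤ x 1 ^ 2 / k := by positivity
    linarith
  unfold greenFn
  split_ifs with h
  · change 1 / (2 * Real.pi * √k * √((r + m * x 0 / k) ^ 2 - machRho m x ^ 2)) = _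
    rw [hfac, mul_assoc, ← Real.sqrt_mul hk.le, mul_div_cancel₀ _ hk.ne', one_div, mul_inv]
  · have h' : r + m * x 0 / k < machRho m x := by
      change ¬(0 ≤ r - (machRho m x - m * x 0 / k)) at h
      linarith [not_le.1 h]
    have hneg : (r + m * x 0 / k) ^ 2 - machRho m x ^ 2 ≤ 0 := by
      have := (abs_le.1 hle).1
      nlinarith
    rw [hfac] at hneg
    have hQ0 : Q ≤ 0 := by
      by_contra! hc
      exact absurd (div_pos hc hk) (not_lt.2 hneg)
    rw [Real.sqrt_eq_zero_of_nonpos hQ0]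
    simp

lemma coneExcess_nonpos {r : ℝ} (hr : r ≤ 0) (v : Plane) : coneExcess r v ≤ 0 := by
  rw [coneExcess, max_eq_right hr]
  nlinarith [sq_nonneg ‖v‖]

lemma greenIntegrand_eq {m : ℝ} (hm0 : 0 ≤ m) (hm1 : m < 1) (t : ℝ≥0) (x : Plane)
    (p : ℝ × Plane) :
    greenIntegrand m t x p = (Ioi (0 : ℝ)).indicator (fun s => (2 * Real.pi)⁻¹ *
      (√(coneExcess (t - s) (driftCentre m t x s - p.2)))⁻¹) p.1 := by
  rw [greenIntegrand]
  by_cases h : p.1 ∈ Ioc (0 : ℝ) t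
  · rw [indicator_of_mem h, indicator_of_mem (mem_Ioi.2 h.1),
      greenFn_eq hm0 hm1 (sub_nonneg.2 h.2), driftCentre, sub_right_comm]
  · rw [indicator_of_notMem h]
    by_cases h0 : p.1 ∈ Ioi (0 : ℝ)
    · have : (t : ℝ) - p.1 ≤ 0 := by
        by_contra! hc
        exact h ⟨h0, by linarith⟩
      rw [indicator_of_mem h0, Real.sqrt_eq_zero_of_nonpos (coneExcess_nonpos this _)]
      simp
    · rw [indicator_of_notMem h0]

lemma measurable_greenIntegrand {m : ℝ} (hm0 : 0 ≤ m) (hm1 : m < 1) (t : ℝ≥0) (x : Plane) :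
    Measurable (greenIntegrand m t x) := by
  have h : greenIntegrand m t x = (Ioi (0 : ℝ) ×ˢ (univ : Set Plane)).indicator
      (fun p => (2 * Real.pi)⁻¹ *
        (√(coneExcess (t - p.1) (driftCentre m t x p.1 - p.2)))⁻¹) := by
    ext p
    rw [greenIntegrand_eq hm0 hm1]
    simp [indicator]
  rw [h]
  refine Measurable.indicator ?_ (measurableSet_Ioi.prod MeasurableSet.univ)
  unfold coneExcess driftCentre
  fun_prop

lemma norm_le_of_coneExcess_pos {r : ℝ} {v : Plane} (h : 0 < coneExcess r v) : ‖v‖ ≤ r := by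
  rw [coneExcess, sub_pos] at h
  have h1 := lt_of_pow_lt_pow_left₀ 2 (le_max_right r 0) h
  rcases lt_max_iff.1 h1 with h | h
  · exact h.le
  · exact absurd h (not_lt.2 (norm_nonneg v))

lemma norm_le_of_greenIntegrand_ne_zero {m : ℝ} (hm0 : 0 ≤ m) (hm1 : m < 1) (t : ℝ≥0)
    (x : Plane) (p : ℝ × Plane) (hp : greenIntegrand m t x p ≠ 0) : ‖p‖ ≤ ‖x‖ + 2 * t := by
  have hs : p.1 ∈ Ioc (0 : ℝ) t := mem_of_indicator_ne_zero hp
  rw [greenIntegrand_eq hm0 hm1, indicator_of_mem (mem_Ioi.2 hs.1)] at hp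
  have hpos : 0 < coneExcess (t - p.1) (driftCentre m t x p.1 - p.2) := by
    by_contra! h
    exact hp (by rw [Real.sqrt_eq_zero_of_nonpos h]; simp)
  have h1 := norm_le_of_coneExcess_pos hpos
  have h2 : ‖driftCentre m t x p.1‖ ≤ ‖x‖ + t := by
    refine (norm_sub_le _ _).trans ?_
    rw [norm_smul, PiLp.norm_single, Real.norm_of_nonneg
      (mul_nonneg hm0 (sub_nonneg.2 hs.2))]
    have : m * (t - p.1) ≤ 1 * (t - p.1) :=
      mul_le_mul_of_nonneg_right hm1.le (sub_nonneg.2 hs.2)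
    simp only [norm_one, mul_one]
    linarith [hs.1]
  have h3 : ‖p.2‖ ≤ ‖driftCentre m t x p.1‖ + ‖driftCentre m t x p.1 - p.2‖ := by
    have := norm_sub_le (driftCentre m t x p.1) (driftCentre m t x p.1 - p.2)
    rwa [sub_sub_cancel] at this
  rw [Prod.norm_def, sup_le_iff, Real.norm_of_nonneg hs.1.le]
  constructor
  · linarith [hs.2, norm_nonneg x, t.coe_nonneg]
  · linarith [hs.1]

end GreenFunction

section Increments

lemma rpow_half_add_mul {D P θ : ℝ} (hP : 0 < P) (hθ : 0 < θ) (hPD : P ≤ D) :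
    (√P)⁻¹ ≤ D ^ θ * P ^ (-(1 / 2 + θ)) := by
  have h1 : (√P)⁻¹ = P ^ θ * P ^ (-(1 / 2 + θ)) := by
    rw [← Real.rpow_add hP, Real.sqrt_eq_rpow, ← Real.rpow_neg hP.le]
    congr 1
    ring
  rw [h1]
  gcongr

lemma abs_inv_sqrt_sub_inv_sqrt_le {P Q D θ : ℝ} (hθ0 : 0 < θ) (hθ1 : θ ≤ 1)
    (hD0 : 0 ≤ D) (hD : 0 < P ∨ 0 < Q → |P - Q| ≤ D) :
    |(√P)⁻¹ - (√Q)⁻¹| ≤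
      D ^ θ * (max P 0 ^ (-(1 / 2 + θ)) + max Q 0 ^ (-(1 / 2 + θ))) := by
  wlog hPQ : Q ≤ P generalizing P Q with H
  · rw [abs_sub_comm, add_comm]
    exact H (fun h => by rw [abs_sub_comm]; exact hD h.symm) (not_le.1 hPQ).le
  have hnn : ∀ x : ℝ, 0 ≤ max x 0 ^ (-(1 / 2 + θ)) := fun x =>
    Real.rpow_nonneg (le_max_right _ _) _
  have hDθ : 0 ≤ D ^ θ := Real.rpow_nonneg hD0 _
  rcases le_or_gt P 0 with hP | hP
  · rw [Real.sqrt_eq_zero_of_nonpos hP, Real.sqrt_eq_zero_of_nonpos (hPQ.trans hP)]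
    simpa using mul_nonneg hDθ (add_nonneg (hnn P) (hnn Q))
  have hD' := hD (Or.inl hP)
  rw [abs_of_nonneg (sub_nonneg.2 hPQ)] at hD'
  rcases le_or_gt Q 0 with hQ | hQ
  · rw [Real.sqrt_eq_zero_of_nonpos hQ, inv_zero, sub_zero, abs_of_nonneg (by positivity), mul_add,
      max_eq_left hP.le]
    have := rpow_half_add_mul hP hθ0 (by linarith : P ≤ D)
    linarith [mul_nonneg hDθ (hnn Q)]
  · have hsP : 0 < √P := Real.sqrt_pos.2 hP
    have hsQ : 0 < √Q := Real.sqrt_pos.2 hQ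
    have hinv : (√P)⁻¹ ≤ (√Q)⁻¹ := inv_anti₀ hsQ (Real.sqrt_le_sqrt hPQ)
    rw [abs_of_nonpos (sub_nonpos.2 hinv), mul_add, max_eq_left hQ.le]
    suffices h : (√Q)⁻¹ - (√P)⁻¹ ≤ D ^ θ * Q ^ (-(1 / 2 + θ)) by
      linarith [mul_nonneg hDθ (hnn P)]
    rcases le_or_gt Q D with hQD | hQD
    · linarith [rpow_half_add_mul hQ hθ0 hQD, inv_pos.2 hsP]
    · have h1 : (√Q)⁻¹ - (√P)⁻¹ ≤ (√Q)⁻¹ * (D / Q) := by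
        have e1 : (√Q)⁻¹ - (√P)⁻¹ = (√Q)⁻¹ * (1 - √Q / √P) := by
          field_simp
        rw [e1]
        gcongr
        have e2 : Q / P ≤ √Q / √P := by
          rw [← Real.sqrt_div hQ.le]
          apply Real.le_sqrt_of_sq_le
          have : Q / P ≤ 1 := (div_le_one hP).2 hPQ
          nlinarith [div_pos hQ hP]
        have e3 : 1 - Q / P ≤ D / Q := by
          rw [one_sub_div hP.ne']
          gcongr
        linarith
      refine h1.trans ?_
      have hDQ : D / Q ≤ (D / Q) ^ θ :=
        Real.self_le_rpow_of_le_one (by positivity) ((div_le_one hQ).2 hQD.le) hθ1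
      calc (√Q)⁻¹ * (D / Q) ≤ (√Q)⁻¹ * (D / Q) ^ θ := by gcongr
        _ = D ^ θ * Q ^ (-(1 / 2 + θ)) := by
          rw [Real.div_rpow hD0 hQ.le, neg_add, Real.rpow_add hQ, Real.rpow_neg hQ.le,
            Real.rpow_neg hQ.le, ← Real.sqrt_eq_rpow]
          ring

lemma abs_coneExcess_sub_le {m : ℝ} (hm0 : 0 ≤ m) (hm1 : m < 1) {T t t' : ℝ} {x x' : Plane}
    (ht0 : 0 ≤ t) (ht0' : 0 ≤ t') (ht : t ≤ T) (ht' : t' ≤ T) (hx : ‖x‖ ≤ T) (hx' : ‖x'‖ ≤ T)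
    {s : ℝ} (hs : 0 < s) (y : Plane)
    (hpos : 0 < coneExcess (t - s) (driftCentre m t x s - y) ∨
      0 < coneExcess (t' - s) (driftCentre m t' x' s - y)) :
    |coneExcess (t - s) (driftCentre m t x s - y) -
      coneExcess (t' - s) (driftCentre m t' x' s - y)| ≤ 7 * T * (|t - t'| + ‖x - x'‖) := by
  set v := driftCentre m t x s - y
  set v' := driftCentre m t' x' s - y
  set d := |t - t'| + ‖x - x'‖
  have htt : |t - t'| ≤ T := abs_sub_le_of_nonneg_of_le ht0 ht ht0' ht'
  have hxx : ‖x - x'‖ ≤ 2 * T := (norm_sub_le _ _).trans (by linarith)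
  have hT : 0 ≤ T := ht0.trans ht
  have hd : ‖v - v'‖ ≤ d := by
    have : v - v' = (x - x') - (m * (t - t')) • EuclideanSpace.single 0 1 := by
      simp only [v, v', driftCentre]
      module
    rw [this]
    refine (norm_sub_le _ _).trans ?_
    rw [norm_smul, PiLp.norm_single, norm_one, mul_one, Real.norm_eq_abs, abs_mul,
      abs_of_nonneg hm0]
    have := mul_le_mul_of_nonneg_right hm1.le (abs_nonneg (t - t'))
    linarith
  have hvv : |‖v‖ - ‖v'‖| ≤ d := (abs_norm_sub_norm_le v v').trans hd
  have hsum : ‖v‖ + ‖v'‖ ≤ 5 * T := by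
    have hd3 : d ≤ 3 * T := by
      simp only [d]
      linarith
    have hb := abs_le.1 hvv
    rcases hpos with h | h
    · linarith [norm_le_of_coneExcess_pos h, hb.1]
    · linarith [norm_le_of_coneExcess_pos h, hb.2]
  have hr : |max (t - s) 0 - max (t' - s) 0| ≤ d := by
    refine (abs_max_sub_max_le_abs _ _ _).trans ?_
    rw [sub_sub_sub_cancel_right]
    linarith [norm_nonneg (x - x')]
  have hr0 : 0 ≤ max (t - s) 0 := le_max_right _ _
  have hr0' : 0 ≤ max (t' - s) 0 := le_max_right _ _
  have hrT : max (t - s) 0 ≤ T := max_le (by linarith) hT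
  have hrT' : max (t' - s) 0 ≤ T := max_le (by linarith) hT
  have e : coneExcess (t - s) v - coneExcess (t' - s) v' =
      (max (t - s) 0 - max (t' - s) 0) * (max (t - s) 0 + max (t' - s) 0)
        - (‖v‖ - ‖v'‖) * (‖v‖ + ‖v'‖) := by
    simp only [coneExcess]
    ring
  have hd0 : 0 ≤ d := (norm_nonneg _).trans hd
  rw [e]
  refine (abs_sub _ _).trans ?_
  rw [abs_mul, abs_mul, abs_of_nonneg (add_nonneg hr0 hr0'),
    abs_of_nonneg (add_nonneg (norm_nonneg v) (norm_nonneg v'))]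
  have h1 : |max (t - s) 0 - max (t' - s) 0| * (max (t - s) 0 + max (t' - s) 0) ≤ d * (2 * T) :=
    mul_le_mul hr (by linarith) (by linarith) hd0
  have h2 : |‖v‖ - ‖v'‖| * (‖v‖ + ‖v'‖) ≤ d * (5 * T) :=
    mul_le_mul hvv hsum (by positivity) hd0
  linarith

lemma walshForm_const_mul {f : ℝ → ℝ} {h : ℝ × Plane → ℝ} (hh : Measurable h) (c : ℝ) :
    walshForm f (fun p => c * h p) (fun p => c * h p) = ‖c‖ₑ ^ 2 * walshForm f h h := by
  rw [walshForm, walshForm, ← lintegral_const_mul _ (by fun_prop)]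
  refine lintegral_congr fun q => ?_
  rw [enorm_mul, enorm_mul]
  ring

lemma exists_walshForm_greenIntegrand_sub_le {f : ℝ → ℝ} (hf : IsNoiseKernel f)
    (hpos : IsPositiveOnTestFn f) {m : ℝ} (hm0 : 0 ≤ m) (hm1 : m < 1) {α θ : ℝ} (hα1 : α < 1)
    (hθ0 : 0 < θ) (hθ : θ < α / 4)
    (hsing : ∀ R : ℝ, ∫⁻ w in Metric.closedBall (0 : Plane) R,
      ENNReal.ofReal (f ‖w‖) * ‖w‖ₑ ^ (-α) < ∞) (T : ℝ) :
    ∃ C : ℝ≥0∞, C ≠ ∞ ∧ ∀ (t t' : ℝ≥0) (x x' : Plane), (t : ℝ) ≤ T → (t' : ℝ) ≤ T →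
      ‖x‖ ≤ T → ‖x'‖ ≤ T →
      walshForm f (fun p => greenIntegrand m t x p - greenIntegrand m t' x' p)
        (fun p => greenIntegrand m t x p - greenIntegrand m t' x' p) ≤
      C * (ENNReal.ofReal (|(t : ℝ) - t'| + ‖x - x'‖) ^ θ) ^ 2 := by
  set γ := 1 / 2 + θ with hγ
  have hE := lintegral_conePower_energy_lt_top (γ := γ) (σ := α / 2) hf (by linarith)
    (by linarith) (by linarith) (by linarith)
    (by simpa only [mul_div_cancel₀ α (two_ne_zero' ℝ)] using hsing) T
  set E := ∫⁻ r in Ioo (0 : ℝ) T, ∫⁻ y : Plane, ∫⁻ z : Plane,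
    ‖conePower γ r y‖ₑ * ‖conePower γ r z‖ₑ * ENNReal.ofReal (f ‖y - z‖)
  refine ⟨(ENNReal.ofReal (7 * T) ^ θ) ^ 2 * (2 * E + 2 * E), ?_, ?_⟩
  · exact ENNReal.mul_ne_top
      (ENNReal.pow_ne_top (ENNReal.rpow_ne_top_of_nonneg hθ0.le ENNReal.ofReal_ne_top)) (by simp [hE.ne, ENNReal.mul_eq_top])
  intro t t' x x' ht ht' hx hx'
  have hT : 0 ≤ T := t.coe_nonneg.trans ht
  set d := |(t : ℝ) - t'| + ‖x - x'‖
  have hd : 0 ≤ d := by positivity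
  set u : ℝ × Plane → ℝ := fun p => conePower γ (t - p.1) (driftCentre m t x p.1 - p.2)
  set u' : ℝ × Plane → ℝ := fun p => conePower γ (t' - p.1) (driftCentre m t' x' p.1 - p.2)
  have hu : Measurable u := measurable_conePower_driftCentre γ m t x
  have hu' : Measurable u' := measurable_conePower_driftCentre γ m t' x'
  have hpt : ∀ p, |greenIntegrand m t x p - greenIntegrand m t' x' p| ≤
      |(7 * T * d) ^ θ * (u p + u' p)| := by
    intro p
    have hnn : 0 ≤ (7 * T * d) ^ θ * (u p + u' p) :=
      mul_nonneg (Real.rpow_nonneg (by positivity) _)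
        (add_nonneg (conePower_nonneg _ _ _) (conePower_nonneg _ _ _))
    rw [abs_of_nonneg hnn, greenIntegrand_eq hm0 hm1, greenIntegrand_eq hm0 hm1]
    by_cases hs : p.1 ∈ Ioi (0 : ℝ)
    · rw [indicator_of_mem hs, indicator_of_mem hs, ← mul_sub, abs_mul]
      have h1 : |(2 * Real.pi)⁻¹| ≤ 1 := by
        rw [abs_of_nonneg (by positivity)]
        exact inv_le_one_of_one_le₀ (by linarith [Real.pi_gt_three])
      refine (mul_le_of_le_one_left (abs_nonneg _) h1).trans ?_
      exact abs_inv_sqrt_sub_inv_sqrt_le hθ0 (by linarith) (by positivity)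
        (abs_coneExcess_sub_le hm0 hm1 t.coe_nonneg t'.coe_nonneg ht ht' hx hx' hs p.2)
    · rw [indicator_of_notMem hs, indicator_of_notMem hs, sub_zero, abs_zero]
      exact hnn
  calc _ ≤ walshForm f (fun p => (7 * T * d) ^ θ * (u p + u' p))
        (fun p => (7 * T * d) ^ θ * (u p + u' p)) := walshForm_mono hpt
    _ = ‖(7 * T * d) ^ θ‖ₑ ^ 2 * walshForm f (fun p => u p + u' p) (fun p => u p + u' p) :=
        walshForm_const_mul (hu.add hu') _
    _ ≤ ‖(7 * T * d) ^ θ‖ₑ ^ 2 * (2 * E + 2 * E) := by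
        gcongr
        refine (hf.walshForm_add_le hpos hu hu').trans ?_
        gcongr
        · exact walshForm_conePower_le hf (by linarith) m ht x
        · exact walshForm_conePower_le hf (by linarith) m ht' x'
    _ = _ := by
        rw [Real.enorm_of_nonneg (Real.rpow_nonneg (by positivity) _),
          ← ENNReal.ofReal_rpow_of_nonneg (by positivity) hθ0.le,
          ENNReal.ofReal_mul (by positivity), ENNReal.mul_rpow_of_nonneg _ _ hθ0.le]
        ring

end Increments

section Dyadic

variable {d : ℕ}

/-- The dyadic point of level `n` with integer coordinates `k`. -/
noncomputable def dyadicPoint (n : ℕ) (k : Fin d → ℤ) : Fin d → ℝ := fun i => k i / 2 ^ n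

/-- Integer coordinates of the dyadic point of level `n` below `v`. -/
noncomputable def dyadicFloor (n : ℕ) (v : Fin d → ℝ) : Fin d → ℤ := fun i => ⌊2 ^ n * v i⌋

/-- The dyadic approximation of level `n`. -/
noncomputable def dyadicApprox (n : ℕ) (v : Fin d → ℝ) : Fin d → ℝ :=
  dyadicPoint n (dyadicFloor n v)

lemma norm_dyadicApprox_sub_le (n : ℕ) (v : Fin d → ℝ) :
    ‖dyadicApprox n v - v‖ ≤ (1 / 2) ^ n := by
  refine (pi_norm_le_iff_of_nonneg (by positivity)).2 fun i => ?_
  have h2 : (0 : ℝ) < 2 ^ n := by positivity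
  have h : dyadicApprox n v i - v i = (⌊2 ^ n * v i⌋ - 2 ^ n * v i) / 2 ^ n := by
    simp only [dyadicApprox, dyadicPoint, dyadicFloor]
    field_simp
  rw [Pi.sub_apply, h, Real.norm_eq_abs, abs_div, abs_of_pos h2, one_div_pow]
  gcongr
  rw [abs_le]
  constructor <;> linarith [Int.floor_le (2 ^ n * v i), Int.lt_floor_add_one (2 ^ n * v i)]

lemma dyadicPoint_succ (n : ℕ) (k : Fin d → ℤ) :
    dyadicPoint (n + 1) (fun i => 2 * k i) = dyadicPoint n k := by
  ext i
  simp only [dyadicPoint]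
  push_cast
  rw [pow_succ]
  field_simp

lemma abs_floor_sub_floor_le {a b : ℝ} {L : ℤ} (h : |a - b| ≤ L) : |⌊a⌋ - ⌊b⌋| ≤ L + 1 := by
  have h1 := abs_le.1 h
  have a1 := Int.floor_le a
  have a2 := Int.lt_floor_add_one a
  have b1 := Int.floor_le b
  have b2 := Int.lt_floor_add_one b
  have e1 : ((⌊a⌋ - ⌊b⌋ : ℤ) : ℝ) < ((L + 1 + 1 : ℤ) : ℝ) := by push_cast; linarith
  have e2 : ((-(L + 1) - 1 : ℤ) : ℝ) < ((⌊a⌋ - ⌊b⌋ : ℤ) : ℝ) := by push_cast; linarith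
  rw [Int.cast_lt] at e1 e2
  rw [abs_le]
  constructor <;> omega

lemma abs_dyadicFloor_le (n R : ℕ) {v : Fin d → ℝ} (hv : ‖v‖ ≤ R) (i : Fin d) :
    |dyadicFloor n v i| ≤ (R + 1) * 2 ^ n := by
  have h1 : |v i| ≤ R := (norm_le_pi_norm v i).trans hv
  have h2 : |2 ^ n * v i - 0| ≤ ((R * 2 ^ n : ℤ) : ℝ) := by
    rw [sub_zero, abs_mul, abs_of_pos (by positivity), mul_comm]
    push_cast
    gcongr
  have := abs_floor_sub_floor_le h2
  rw [Int.floor_zero, sub_zero] at this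
  refine this.trans ?_
  have : (1 : ℤ) ≤ 2 ^ n := one_le_pow₀ (by norm_num)
  linarith

/-- The increments of `z` between dyadic points of level `n` with coordinates bounded by
`(R + 1) 2^n` and at distance at most `L` steps are at most `K ρ^n`. -/
def DyadicBound (z : (Fin d → ℝ) → ℝ) (R L : ℕ) (K ρ : ℝ) : Prop :=
  ∀ (n : ℕ) (k k' : Fin d → ℤ), (∀ i, |k i| ≤ (R + 1) * 2 ^ n) → (∀ i, |k' i| ≤ (R + 1) * 2 ^ n) →
    (∀ i, |k i - k' i| ≤ L) → |z (dyadicPoint n k) - z (dyadicPoint n k')| ≤ K * ρ ^ n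

variable {z : (Fin d → ℝ) → ℝ} {R L : ℕ} {K ρ : ℝ}

lemma DyadicBound.dist_succ_le (h : DyadicBound z R L K ρ) (hL : 1 ≤ L) (hK : 0 ≤ K)
    (hρ0 : 0 ≤ ρ) (hρ1 : ρ ≤ 1) {v : Fin d → ℝ} (hv : ‖v‖ ≤ R) (n : ℕ) :
    dist (z (dyadicApprox n v)) (z (dyadicApprox (n + 1) v)) ≤ K * ρ ^ n := by
  rw [Real.dist_eq, dyadicApprox, dyadicApprox, ← dyadicPoint_succ]
  refine (h (n + 1) _ _ (fun i => ?_) (abs_dyadicFloor_le (n + 1) R hv) fun i => ?_).trans ?_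
  · rw [abs_mul, pow_succ]
    have := abs_dyadicFloor_le n R hv i
    norm_num
    linarith
  · have a1 := Int.floor_le (2 ^ n * v i)
    have a2 := Int.lt_floor_add_one (2 ^ n * v i)
    have b1 := Int.floor_le (2 ^ (n + 1) * v i)
    have b2 := Int.lt_floor_add_one (2 ^ (n + 1) * v i)
    have e : (2 : ℝ) ^ (n + 1) * v i = 2 * (2 ^ n * v i) := by ring
    simp only [dyadicFloor]
    rw [e] at b1 b2 ⊢
    have e1 : ((⌊2 * (2 ^ n * v i)⌋ : ℤ) : ℝ) < ((2 * ⌊2 ^ n * v i⌋ + 2 : ℤ) : ℝ) := by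
      push_cast; linarith
    have e2 : ((2 * ⌊2 ^ n * v i⌋ - 1 : ℤ) : ℝ) < ((⌊2 * (2 ^ n * v i)⌋ : ℤ) : ℝ) := by
      push_cast; linarith
    rw [Int.cast_lt] at e1 e2
    have hL' : (1 : ℤ) ≤ L := by exact_mod_cast hL
    rw [abs_le]
    constructor <;> omega
  · rw [pow_succ]
    exact mul_le_mul_of_nonneg_left (mul_le_of_le_one_right (pow_nonneg hρ0 n) hρ1) hK

/-- Hölder continuity of the limit along dyadic approximations. -/
lemma DyadicBound.abs_sub_le {b : ℝ} (hb : 0 < b) (hR : 1 ≤ R)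
    (h : DyadicBound z R (2 * R + 1) K (2 ^ (-b))) (hK : 0 ≤ K) {v w : Fin d → ℝ}
    (hv : ‖v‖ ≤ R) (hw : ‖w‖ ≤ R) {l l' : ℝ}
    (hl : Tendsto (fun n => z (dyadicApprox n v)) atTop (𝓝 l))
    (hl' : Tendsto (fun n => z (dyadicApprox n w)) atTop (𝓝 l')) :
    |l - l'| ≤ K * (2 / (1 - 2 ^ (-b)) + 1) * ‖v - w‖ ^ b := by
  set ρ : ℝ := 2 ^ (-b) with hρ
  have hρ0 : 0 < ρ := by positivity
  have hρ1 : ρ < 1 := Real.rpow_lt_one_of_one_lt_of_neg (by norm_num) (by linarith)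
  rcases eq_or_ne v w with rfl | hvw
  · rw [tendsto_nhds_unique hl hl', sub_self, abs_zero, sub_self, norm_zero,
      Real.zero_rpow hb.ne', mul_zero]
  have hR' : (1 : ℝ) ≤ R := by exact_mod_cast hR
  have hδ : 0 < ‖v - w‖ := norm_pos_iff.2 (sub_ne_zero.2 hvw)
  have hδ2 : ‖v - w‖ ≤ 2 * R := (norm_sub_le _ _).trans (by linarith)
  obtain ⟨n, hn1, hn2⟩ := exists_nat_pow_near (x := 2 * R / ‖v - w‖) (y := (2 : ℝ))
    ((one_le_div hδ).2 hδ2) (by norm_num)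
  rw [le_div_iff₀ hδ] at hn1
  rw [div_lt_iff₀ hδ, pow_succ] at hn2
  have hρn : ρ ^ n ≤ ‖v - w‖ ^ b := by
    rw [hρ, ← Real.rpow_natCast, ← Real.rpow_mul (by norm_num), mul_comm, Real.rpow_mul (by norm_num),
      Real.rpow_natCast, Real.rpow_neg (by positivity), ← Real.inv_rpow (by positivity)]
    refine Real.rpow_le_rpow (by positivity) ?_ hb.le
    rw [inv_le_iff_one_le_mul₀ (by positivity)]
    nlinarith
  have h1 := dist_le_of_le_geometric_of_tendsto ρ K hρ1
    (fun n => h.dist_succ_le (by omega) hK hρ0.le hρ1.le hv n) hl n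
  have h2 := dist_le_of_le_geometric_of_tendsto ρ K hρ1
    (fun n => h.dist_succ_le (by omega) hK hρ0.le hρ1.le hw n) hl' n
  have h3 := h n (dyadicFloor n v) (dyadicFloor n w) (abs_dyadicFloor_le n R hv)
    (abs_dyadicFloor_le n R hw) fun i => by
      have : |2 ^ n * v i - 2 ^ n * w i| ≤ ((2 * R : ℤ) : ℝ) := by
        rw [← mul_sub, abs_mul, abs_of_pos (by positivity)]
        push_cast
        refine le_trans ?_ hn1
        gcongr
        exact norm_le_pi_norm (v - w) i
      have := abs_floor_sub_floor_le this
      push_cast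
      exact this
  rw [Real.dist_eq] at h1 h2
  have h4 : |l - l'| ≤ K * ρ ^ n / (1 - ρ) + K * ρ ^ n + K * ρ ^ n / (1 - ρ) := by
    have e : l - l' = -(z (dyadicApprox n v) - l) +
        (z (dyadicApprox n v) - z (dyadicApprox n w)) + (z (dyadicApprox n w) - l') := by ring
    rw [e]
    refine (abs_add_three _ _ _).trans ?_
    rw [abs_neg]
    exact add_le_add (add_le_add h1 h3) h2
  have h5 : K * ρ ^ n / (1 - ρ) + K * ρ ^ n + K * ρ ^ n / (1 - ρ) =
      K * (2 / (1 - ρ) + 1) * ρ ^ n := by ring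
  rw [h5] at h4
  have : 0 ≤ K * (2 / (1 - ρ) + 1) := by
    have : 0 < 1 - ρ := by linarith
    positivity
  exact h4.trans (mul_le_mul_of_nonneg_left hρn this)

end Dyadic

section KolmogorovChentsov

variable {d : ℕ} {Ω : Type*} [MeasurableSpace Ω] {P : Measure Ω} {Z : (Fin d → ℝ) → Ω → ℝ}

/-- Coordinates of the dyadic points of level `n` in the box of radius `R + 1`. -/
noncomputable def dyadicGrid (d R n : ℕ) : Finset (Fin d → ℤ) :=
  Fintype.piFinset fun _ => Finset.Icc (-((R + 1) * 2 ^ n)) ((R + 1) * 2 ^ n)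

lemma mem_dyadicGrid {R n : ℕ} {k : Fin d → ℤ} :
    k ∈ dyadicGrid d R n ↔ ∀ i, |k i| ≤ (R + 1) * 2 ^ n := by
  simp [dyadicGrid, abs_le]

lemma card_dyadicGrid_le (R n : ℕ) :
    (dyadicGrid d R n).card ≤ ((2 * R + 3) * 2 ^ n) ^ d := by
  rw [dyadicGrid, Fintype.card_piFinset_const, Int.card_Icc]
  gcongr
  rw [Int.toNat_le]
  push_cast
  have : (1 : ℤ) ≤ 2 ^ n := one_le_pow₀ (by norm_num)
  linarith

/-- Moment bounds of all orders imply dyadic bounds almost surely. -/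
lemma ae_exists_dyadicBound (hZ : ∀ v, Measurable (Z v)) {b θ : ℝ} (hθ0 : 0 < θ) (hbθ : b < θ)
    (R L : ℕ)
    (hmom : ∀ p : ℕ, 1 ≤ p → ∃ C : ℝ≥0∞, C ≠ ∞ ∧ ∀ v w, ‖v‖ ≤ R + 1 → ‖w‖ ≤ R + 1 →
      eLpNorm (fun ω => Z v ω - Z w ω) p P ≤ C * ENNReal.ofReal (‖v - w‖ ^ θ)) :
    ∀ᵐ ω ∂P, ∃ K : ℝ, 0 ≤ K ∧ DyadicBound (fun v => Z v ω) R L K (2 ^ (-b)) := by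
  set η : ℝ := 2 ^ (-(θ - b)) with hη
  have hη0 : 0 < η := by positivity
  have hη1 : η < 1 := Real.rpow_lt_one_of_one_lt_of_neg (by norm_num) (by linarith)
  obtain ⟨p₀, hp₀⟩ := exists_pow_lt_of_lt_one (show (0 : ℝ) < ((2 : ℝ) ^ (2 * d))⁻¹ by positivity) hη1
  set p := p₀ + 1
  have hp1 : 1 ≤ p := by omega
  have hηp : (2 : ℝ) ^ (2 * d) * η ^ p < 1 := by
    have : η ^ p < ((2 : ℝ) ^ (2 * d))⁻¹ :=
      (pow_le_pow_of_le_one hη0.le hη1.le (by omega)).trans_lt hp₀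
    rwa [lt_inv_comm₀ (by positivity) (by positivity), ← one_div, lt_div_iff₀ (by positivity)]
      at this
  obtain ⟨C, hC, hCb⟩ := hmom p hp1
  set B : ℕ → ℝ := fun n => 2 ^ (b * n) with hB
  let S : ℕ → Ω → ℝ≥0∞ := fun n ω => ∑ kk ∈ (dyadicGrid d R n ×ˢ dyadicGrid d R n).filter
    (fun kk => ∀ i, |kk.1 i - kk.2 i| ≤ (L : ℤ)),
      (‖Z (dyadicPoint n kk.1) ω - Z (dyadicPoint n kk.2) ω‖ₑ * ENNReal.ofReal (B n)) ^ p
  have hSm : ∀ n, Measurable (S n) := fun n => by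
    refine Finset.measurable_sum _ fun kk _ => ?_
    have h1 := hZ (dyadicPoint n kk.1)
    have h2 := hZ (dyadicPoint n kk.2)
    fun_prop
  set c : ℝ≥0∞ := (C * ENNReal.ofReal ((L : ℝ) ^ θ)) ^ p * ((2 * R + 3 : ℝ≥0∞) ^ (2 * d)) with hc
  have hc_top : c ≠ ∞ := by
    refine ENNReal.mul_ne_top (ENNReal.pow_ne_top (ENNReal.mul_ne_top hC (by simp)))
      (ENNReal.pow_ne_top ?_)
    exact ENNReal.add_ne_top.2 ⟨ENNReal.mul_ne_top (by simp) (by simp), by simp⟩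
  have hnorm : ∀ n, ∀ k ∈ dyadicGrid d R n, ‖dyadicPoint n k‖ ≤ R + 1 := by
    intro n k hk
    refine (pi_norm_le_iff_of_nonneg (by positivity)).2 fun i => ?_
    have h1 := mem_dyadicGrid.1 hk i
    rw [dyadicPoint, Real.norm_eq_abs, abs_div, abs_of_pos (show (0 : ℝ) < 2 ^ n by positivity),
      div_le_iff₀ (by positivity)]
    exact_mod_cast h1
  have hterm : ∀ n, ∀ k ∈ dyadicGrid d R n, ∀ k' ∈ dyadicGrid d R n,
      (∀ i, |k i - k' i| ≤ (L : ℤ)) →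
      ∫⁻ ω, (‖Z (dyadicPoint n k) ω - Z (dyadicPoint n k') ω‖ₑ * ENNReal.ofReal (B n)) ^ p ∂P ≤
        (C * ENNReal.ofReal ((L : ℝ) ^ θ)) ^ p * ENNReal.ofReal (η ^ n) ^ p := by
    intro n k hk k' hk' hkk
    have h2n : (0 : ℝ) < 2 ^ n := by positivity
    have hd : ‖dyadicPoint n k - dyadicPoint n k'‖ ≤ L / 2 ^ n := by
      refine (pi_norm_le_iff_of_nonneg (by positivity)).2 fun i => ?_
      have e : (dyadicPoint n k - dyadicPoint n k') i = ((k i - k' i : ℤ) : ℝ) / 2 ^ n := by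
        simp only [Pi.sub_apply, dyadicPoint]
        push_cast
        ring
      rw [e, Real.norm_eq_abs, abs_div, abs_of_pos h2n]
      gcongr
      exact_mod_cast hkk i
    have hlp := hCb _ _ (hnorm n k hk) (hnorm n k' hk')
    rw [eLpNorm_eq_lintegral_rpow_enorm_toReal (by simp) (by simp)] at hlp
    simp only [ENNReal.toReal_natCast, ENNReal.rpow_natCast] at hlp
    rw [one_div, ENNReal.rpow_inv_le_iff (by positivity), ENNReal.rpow_natCast] at hlp
    have h1 := hZ (dyadicPoint n k)
    have h2 := hZ (dyadicPoint n k')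
    simp_rw [mul_pow]
    rw [lintegral_mul_const _ (by fun_prop), ← mul_pow, ← mul_pow]
    refine (mul_le_mul_left hlp _).trans ?_
    rw [← mul_pow]
    gcongr ?_ ^ p
    rw [mul_assoc, mul_assoc, ← ENNReal.ofReal_mul (by positivity),
      ← ENNReal.ofReal_mul (by positivity)]
    refine mul_le_mul_right (ENNReal.ofReal_le_ofReal ?_) C
    calc ‖dyadicPoint n k - dyadicPoint n k'‖ ^ θ * B n ≤ (L / 2 ^ n) ^ θ * B n := by
          gcongr
      _ = (L : ℝ) ^ θ * η ^ n := by
          rw [Real.div_rpow (by positivity) h2n.le, hη, hB, ← Real.rpow_natCast (2 ^ (-(θ - b))),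
            ← Real.rpow_mul (by norm_num), ← Real.rpow_natCast 2 n, ← Real.rpow_mul (by norm_num),
            div_mul_eq_mul_div, mul_div_assoc, ← Real.rpow_sub (by norm_num)]
          congr 2
          ring
  have hSint : ∀ n, ∫⁻ ω, S n ω ∂P ≤ c * ENNReal.ofReal (2 ^ (2 * d) * η ^ p) ^ n := by
    intro n
    simp only [S]
    rw [lintegral_finsetSum _ fun kk _ => by
      have h1 := hZ (dyadicPoint n kk.1)
      have h2 := hZ (dyadicPoint n kk.2)
      fun_prop]
    refine (Finset.sum_le_card_nsmul _ _
      ((C * ENNReal.ofReal ((L : ℝ) ^ θ)) ^ p * ENNReal.ofReal (η ^ n) ^ p) fun kk hkk => ?_).trans ?_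
    · rw [Finset.mem_filter, Finset.mem_product] at hkk
      exact hterm n _ hkk.1.1 _ hkk.1.2 hkk.2
    · rw [nsmul_eq_mul]
      have hcard : ((((dyadicGrid d R n ×ˢ dyadicGrid d R n).filter
          (fun kk => ∀ i, |kk.1 i - kk.2 i| ≤ (L : ℤ))).card : ℕ) : ℝ≥0∞) ≤
          (((2 * R + 3) * 2 ^ n) ^ d * ((2 * R + 3) * 2 ^ n) ^ d : ℕ) := by
        refine Nat.cast_le.2 ((Finset.card_filter_le _ _).trans ?_)
        rw [Finset.card_product]
        exact Nat.mul_le_mul (card_dyadicGrid_le R n) (card_dyadicGrid_le R n)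
      refine (mul_le_mul_left hcard _).trans (le_of_eq ?_)
      rw [hc, ENNReal.ofReal_mul (by positivity), ENNReal.ofReal_pow (by positivity),
        ENNReal.ofReal_pow (by positivity), ENNReal.ofReal_pow hη0.le]
      push_cast
      simp only [ENNReal.ofReal_ofNat, mul_pow]
      ring
  have hfin : ∫⁻ ω, ∑' n, S n ω ∂P ≠ ∞ := by
    rw [lintegral_tsum fun n => (hSm n).aemeasurable]
    refine ne_top_of_le_ne_top ?_ (ENNReal.tsum_le_tsum hSint)
    rw [ENNReal.tsum_mul_left, ENNReal.tsum_geometric]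
    refine ENNReal.mul_ne_top hc_top (ENNReal.inv_ne_top.2 ?_)
    rw [ne_eq, tsub_eq_zero_iff_le, not_le, ENNReal.ofReal_lt_one]
    exact hηp
  filter_upwards [ae_lt_top (Measurable.tsum hSm) hfin] with ω hω
  set s := ∑' n, S n ω
  refine ⟨1 + s.toReal, by positivity, fun n k k' hk hk' hkk => ?_⟩
  set e : ℝ := |Z (dyadicPoint n k) ω - Z (dyadicPoint n k') ω|
  have hBpos : 0 < B n := by positivity
  have hle : (ENNReal.ofReal (e * B n)) ^ p ≤ s := by
    refine le_trans ?_ (ENNReal.le_tsum n)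
    have hmem : (k, k') ∈ (dyadicGrid d R n ×ˢ dyadicGrid d R n).filter
        (fun kk => ∀ i, |kk.1 i - kk.2 i| ≤ (L : ℤ)) :=
      Finset.mem_filter.2 ⟨Finset.mk_mem_product (mem_dyadicGrid.2 hk) (mem_dyadicGrid.2 hk'), hkk⟩
    refine le_trans (le_of_eq ?_) (Finset.single_le_sum (f := fun kk : (Fin d → ℤ) × (Fin d → ℤ) =>
      (‖Z (dyadicPoint n kk.1) ω - Z (dyadicPoint n kk.2) ω‖ₑ * ENNReal.ofReal (B n)) ^ p)
      (fun _ _ => zero_le) hmem)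
    rw [ENNReal.ofReal_mul (abs_nonneg _), ← Real.norm_eq_abs, ofReal_norm]
  have hle' : (e * B n) ^ p ≤ s.toReal := by
    rw [← ENNReal.ofReal_pow (by positivity)] at hle
    exact (ENNReal.ofReal_le_iff_le_toReal hω.ne).1 hle
  have hfinal : e * B n ≤ 1 + s.toReal := by
    rcases le_total (e * B n) 1 with h | h
    · linarith [s.toReal_nonneg]
    · linarith [le_self_pow₀ h (by omega : p ≠ 0)]
  have hBinv : ((2 : ℝ) ^ (-b)) ^ n = (B n)⁻¹ := by
    rw [← Real.rpow_natCast, ← Real.rpow_mul (by norm_num), hB, ← Real.rpow_neg (by norm_num)]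
    congr 1
    ring
  rw [hBinv, ← div_eq_mul_inv, le_div_iff₀ hBpos]
  exact hfinal

/-- **Kolmogorov–Chentsov**: a real process on `ℝ^d` whose increments have moments of all orders
bounded by those of a `θ`-Hölder function for every `θ < γ` has a modification whose paths are all
locally Hölder continuous of every order less than `γ`. -/
theorem exists_holder_modification [IsFiniteMeasure P] (hZ : ∀ v, Measurable (Z v)) {γ : ℝ}
    (hγ : 0 < γ)
    (hmom : ∀ (R : ℕ) (θ : ℝ), 0 < θ → θ < γ → ∀ p : ℕ, 1 ≤ p → ∃ C : ℝ≥0∞, C ≠ ∞ ∧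
      ∀ v w, ‖v‖ ≤ R → ‖w‖ ≤ R →
        eLpNorm (fun ω => Z v ω - Z w ω) p P ≤ C * ENNReal.ofReal (‖v - w‖ ^ θ)) :
    ∃ Z' : (Fin d → ℝ) → Ω → ℝ, (∀ v, Measurable (Z' v)) ∧ (∀ v, Z' v =ᵐ[P] Z v) ∧
      ∀ ω, ∀ b : ℝ, 0 < b → b < γ → ∀ R : ℕ, ∃ C : ℝ, 0 ≤ C ∧
        ∀ v w, ‖v‖ ≤ R → ‖w‖ ≤ R → |Z' v ω - Z' w ω| ≤ C * ‖v - w‖ ^ b := by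
  have hgood : ∀ᵐ ω ∂P, ∀ b : ℝ, 0 < b → b < γ → ∀ R : ℕ, ∃ K : ℝ, 0 ≤ K ∧
      DyadicBound (fun v => Z v ω) R (2 * R + 1) K (2 ^ (-b)) := by
    have h1 : ∀ᵐ ω ∂P, ∀ j R : ℕ, ∃ K : ℝ, 0 ≤ K ∧
        DyadicBound (fun v => Z v ω) R (2 * R + 1) K (2 ^ (-(γ - γ / (j + 2)))) := by
      refine ae_all_iff.2 fun j => ae_all_iff.2 fun R => ?_
      have hj : 0 < γ / (j + 2) := by positivity
      have hj2 : γ / (j + 2) ≤ γ / 2 := by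
        gcongr
        linarith [(j.cast_nonneg : (0 : ℝ) ≤ j)]
      refine ae_exists_dyadicBound hZ (θ := γ - γ / (j + 2) / 2) (by linarith) (by linarith) R _ ?_
      have := hmom (R + 1) (γ - γ / (j + 2) / 2) (by linarith) (by linarith)
      simpa only [Nat.cast_add, Nat.cast_one] using this
    filter_upwards [h1] with ω hω b hb hbγ R
    obtain ⟨j, hj⟩ := exists_nat_gt (γ / (γ - b))
    obtain ⟨K, hK, hD⟩ := hω j R
    refine ⟨K, hK, fun n k k' h2 h3 h4 => (hD n k k' h2 h3 h4).trans ?_⟩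
    have : γ / (j + 2) ≤ γ - b := by
      rw [div_lt_iff₀ (by linarith)] at hj
      rw [div_le_iff₀ (by positivity)]
      nlinarith
    gcongr
    · norm_num
    · linarith
  set N := toMeasurable P {ω | ¬∀ b : ℝ, 0 < b → b < γ → ∀ R : ℕ, ∃ K : ℝ, 0 ≤ K ∧
      DyadicBound (fun v => Z v ω) R (2 * R + 1) K (2 ^ (-b))}
  have hN : MeasurableSet N := measurableSet_toMeasurable _ _
  have hN0 : P N = 0 := by
    rw [measure_toMeasurable]
    exact hgood
  have hNc : ∀ ω ∉ N, ∀ b : ℝ, 0 < b → b < γ → ∀ R : ℕ, ∃ K : ℝ, 0 ≤ K ∧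
      DyadicBound (fun v => Z v ω) R (2 * R + 1) K (2 ^ (-b)) := fun ω hω => by
    by_contra h
    exact hω (subset_toMeasurable _ _ h)
  let Y : ℕ → (Fin d → ℝ) → Ω → ℝ := fun n v => Nᶜ.indicator (Z (dyadicApprox n v))
  have hYm : ∀ n v, Measurable (Y n v) := fun n v => (hZ _).indicator hN.compl
  have hconv : ∀ v ω, ∃ l, Tendsto (fun n => Y n v ω) atTop (𝓝 l) := by
    intro v ω
    by_cases hω : ω ∈ N
    · exact ⟨0, by simp [Y, hω]⟩
    · obtain ⟨R, hR⟩ := exists_nat_ge ‖v‖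
      obtain ⟨K, hK, hD⟩ := hNc ω hω (γ / 2) (by linarith) (by linarith) R
      have hρ1 : (2 : ℝ) ^ (-(γ / 2)) < 1 :=
        Real.rpow_lt_one_of_one_lt_of_neg (by norm_num) (by linarith)
      have hc := cauchySeq_of_le_geometric _ K hρ1 fun n =>
        hD.dist_succ_le (by omega) hK (by positivity) hρ1.le hR n
      obtain ⟨l, hl⟩ := cauchySeq_tendsto_of_complete hc
      exact ⟨l, by simpa [Y, hω] using hl⟩
  choose Z' hZ' using hconv
  refine ⟨Z', fun v => ?_, fun v => ?_, fun ω b hb hbγ R => ?_⟩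
  · exact measurable_of_tendsto_metrizable (fun n => hYm n v)
      (tendsto_pi_nhds.2 fun ω => hZ' v ω)
  · obtain ⟨R, hR⟩ := exists_nat_ge (‖v‖ + 1)
    obtain ⟨C, hC, hCb⟩ := hmom R (γ / 2) (by linarith) (by linarith) 1 le_rfl
    have hNae : ∀ᵐ ω ∂P, ω ∉ N := measure_eq_zero_iff_ae_notMem.1 hN0
    have t1 : TendstoInMeasure P (fun n => Z (dyadicApprox n v)) atTop (Z' v) := by
      refine tendstoInMeasure_of_tendsto_ae (fun n => (hZ _).aestronglyMeasurable) ?_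
      filter_upwards [hNae] with ω hω
      simpa [Y, hω] using hZ' v ω
    have t2 : TendstoInMeasure P (fun n => Z (dyadicApprox n v)) atTop (Z v) := by
      refine tendstoInMeasure_of_tendsto_eLpNorm (p := 1) (by simp)
        (fun n => (hZ _).aestronglyMeasurable) (hZ v).aestronglyMeasurable ?_
      have hlim : Tendsto (fun n : ℕ => C * ENNReal.ofReal (((1 / 2 : ℝ) ^ n) ^ (γ / 2))) atTop
          (𝓝 0) := by
        have e1 := tendsto_pow_atTop_nhds_zero_of_lt_one (r := (1 / 2 : ℝ)) (by norm_num)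
          (by norm_num)
        have e2 := e1.rpow_const (p := γ / 2) (Or.inr (by linarith))
        rw [Real.zero_rpow (by linarith)] at e2
        have e3 := ENNReal.Tendsto.const_mul (a := C) (ENNReal.tendsto_ofReal e2) (Or.inr hC)
        simpa using e3
      refine tendsto_of_tendsto_of_tendsto_of_le_of_le tendsto_const_nhds hlim
        (fun _ => zero_le) fun n => ?_
      have hn := norm_dyadicApprox_sub_le n v
      have hn1 : (1 / 2 : ℝ) ^ n ≤ 1 := pow_le_one₀ (by norm_num) (by norm_num)
      have hn2 : ‖dyadicApprox n v‖ ≤ R := by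
        have := norm_add_le (dyadicApprox n v - v) v
        rw [sub_add_cancel] at this
        linarith
      have := hCb (dyadicApprox n v) v hn2 (by linarith)
      rw [Nat.cast_one] at this
      refine this.trans ?_
      gcongr
    exact tendstoInMeasure_ae_unique t1 t2
  · by_cases hω : ω ∈ N
    · have h0 : ∀ v, Z' v ω = 0 := fun v =>
        tendsto_nhds_unique (hZ' v ω) (by simp [Y, hω])
      exact ⟨0, le_rfl, fun v w _ _ => by simp [h0]⟩
    · obtain ⟨K, hK, hD⟩ := hNc ω hω b hb hbγ (R + 1)
      have hρ1 : (2 : ℝ) ^ (-b) < 1 :=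
        Real.rpow_lt_one_of_one_lt_of_neg (by norm_num) (by linarith)
      refine ⟨K * (2 / (1 - 2 ^ (-b)) + 1), ?_, fun v w hv hw => ?_⟩
      · have : 0 < 1 - (2 : ℝ) ^ (-b) := by linarith
        positivity
      · refine hD.abs_sub_le hb (by omega) hK (hv.trans ?_) (hw.trans ?_)
          (by simpa [Y, hω] using hZ' v ω) (by simpa [Y, hω] using hZ' w ω) <;>
        · push_cast
          linarith

end KolmogorovChentsov

section RadialProfile

variable {f : ℝ → ℝ}

lemma ae_indicator_norm_sub_eq (f : ℝ → ℝ) (y : Plane) :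
    ∀ᵐ z : Plane, (Ioi (0 : ℝ)).indicator f ‖y - z‖ = f ‖y - z‖ := by
  have h : ∀ᵐ z : Plane, z ≠ y := by simp [ae_iff]
  filter_upwards [h] with z hz
  exact indicator_of_mem (norm_pos_iff.2 (sub_ne_zero.2 hz.symm)) f

lemma walshNormSq_indicator (f : ℝ → ℝ) (g : ℝ × Plane → ℝ) :
    walshNormSq ((Ioi (0 : ℝ)).indicator f) g = walshNormSq f g := by
  refine lintegral_congr fun s => lintegral_congr fun y => lintegral_congr_ae ?_
  filter_upwards [ae_indicator_norm_sub_eq f y] with z hz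
  rw [hz]

lemma IsSpatialGaussianNoise.indicator {Ω : Type*} [MeasurableSpace Ω] {P : Measure Ω}
    {F : TestFn → Ω → ℝ} (hF : IsSpatialGaussianNoise P f F) :
    IsSpatialGaussianNoise P ((Ioi (0 : ℝ)).indicator f) F := by
  refine ⟨hF.gaussian, hF.centred, fun φ ψ => ?_⟩
  rw [hF.covariance]
  congr 1
  ext s
  congr 1
  ext x
  refine integral_congr_ae ?_
  filter_upwards [ae_indicator_norm_sub_eq f x] with y hy
  rw [hy]

lemma isStochIntegral_indicator_iff {Ω : Type*} [MeasurableSpace Ω] {P : Measure Ω}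
    {F : TestFn → Ω → ℝ} {g : ℝ × Plane → ℝ} {Y : Ω → ℝ} :
    IsStochIntegral P ((Ioi (0 : ℝ)).indicator f) F g Y ↔ IsStochIntegral P f F g Y := by
  constructor
  · rintro ⟨h1, h2, h3⟩
    simp only [walshNormSq_indicator] at h3
    exact ⟨h1, h2, h3⟩
  · rintro ⟨h1, h2, h3⟩
    refine ⟨h1, h2, ?_⟩
    simp only [walshNormSq_indicator]
    exact h3

lemma integrableOn_Ioo_of_integrableAtFilter {g : ℝ → ℝ} (hg : ContinuousOn g (Ioi 0))
    (h0 : IntegrableAtFilter g (𝓝[>] 0) volume) (R : ℝ) : IntegrableOn g (Ioo 0 R) := by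
  obtain ⟨s, hs, hgs⟩ := h0
  obtain ⟨ε, hε, hεs⟩ := mem_nhdsGT_iff_exists_Ioo_subset.1 hs
  have hε' : (0 : ℝ) < ε := hε
  have h1 : IntegrableOn g (Icc (ε / 2) R) :=
    (hg.mono fun x hx => lt_of_lt_of_le (half_pos hε') hx.1).integrableOn_compact isCompact_Icc
  refine ((hgs.mono_set hεs).union h1).mono_set fun x hx => ?_
  rcases lt_or_ge x ε with h | h
  · exact Or.inl ⟨hx.1, h⟩
  · exact Or.inr ⟨by linarith, hx.2.le⟩

lemma lintegral_closedBall_mul_norm_rpow_lt_top (hf_cont : ContinuousOn f (Ioi 0))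
    (hf_nonneg : ∀ r, 0 < r → 0 ≤ f r) {α : ℝ}
    (hfα : IntegrableAtFilter (fun r : ℝ => f r * r ^ (1 - α)) (𝓝[>] 0) volume) (R : ℝ) :
    ∫⁻ w in Metric.closedBall (0 : Plane) R,
      ENNReal.ofReal ((Ioi (0 : ℝ)).indicator f ‖w‖) * ‖w‖ₑ ^ (-α) < ∞ := by
  have hc : ContinuousOn (fun r : ℝ => f r * r ^ (1 - α)) (Ioi 0) :=
    hf_cont.mul (continuousOn_id.rpow_const fun x hx => Or.inl (ne_of_gt hx))
  have h1 := integrableOn_Ioo_of_integrableAtFilter hc hfα (|R| + 1)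
  have h2 : IntegrableOn (fun w : Plane => (Ioi (0 : ℝ)).indicator f ‖w‖ * ‖w‖ ^ (-α))
      (Metric.ball 0 (|R| + 1)) := by
    refine (integrableOn_fun_norm_addHaar volume
      (f := fun r : ℝ => (Ioi (0 : ℝ)).indicator f r * r ^ (-α))).2 ?_
    refine h1.congr_fun (fun r hr => ?_) measurableSet_Ioo
    simp only [finrank_euclideanSpace, Fintype.card_fin, smul_eq_mul]
    rw [indicator_of_mem (mem_Ioi.2 hr.1), show 1 - α = 1 + -α by ring, Real.rpow_add hr.1,
      Real.rpow_one]
    norm_num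
    ring
  refine lt_of_le_of_lt (lintegral_mono_set (t := Metric.ball 0 (|R| + 1)) ?_)
    (lt_of_le_of_lt (le_of_eq ?_) h2.hasFiniteIntegral)
  · exact Metric.closedBall_subset_ball (by linarith [le_abs_self R])
  · refine lintegral_congr_ae ?_
    have : ∀ᵐ y : Plane ∂volume.restrict (Metric.ball 0 (|R| + 1)), y ≠ 0 :=
      ae_restrict_of_ae (by simp [ae_iff])
    filter_upwards [this] with w hw
    have hw0 := norm_pos_iff.2 hw
    rw [indicator_of_mem (mem_Ioi.2 hw0), enorm_mul, Real.enorm_of_nonneg (hf_nonneg _ hw0),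
      Real.enorm_of_nonneg (Real.rpow_nonneg hw0.le _), ← ENNReal.ofReal_rpow_of_pos hw0,
      ofReal_norm]

lemma isNoiseKernel_indicator (hf_cont : ContinuousOn f (Ioi 0))
    (hf_nonneg : ∀ r, 0 < r → 0 ≤ f r) {α : ℝ} (hα0 : 0 < α)
    (hfα : IntegrableAtFilter (fun r : ℝ => f r * r ^ (1 - α)) (𝓝[>] 0) volume) :
    IsNoiseKernel ((Ioi (0 : ℝ)).indicator f) := by
  classical
  have hm : Measurable ((Ioi (0 : ℝ)).indicator f) := by
    rw [← piecewise_eq_indicator]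
    exact hf_cont.measurable_piecewise continuousOn_const measurableSet_Ioi
  refine ⟨hm, fun r => indicator_nonneg (fun r hr => hf_nonneg r hr) r, fun R => ?_⟩
  have hmf : Measurable fun w : Plane => ENNReal.ofReal ((Ioi (0 : ℝ)).indicator f ‖w‖) :=
    (hm.comp measurable_norm).ennreal_ofReal
  have h1 : ∫⁻ w in Metric.closedBall (0 : Plane) R,
      ENNReal.ofReal ((Ioi (0 : ℝ)).indicator f ‖w‖) ≤
      ∫⁻ w in Metric.closedBall (0 : Plane) R, ENNReal.ofReal R ^ α *
        (ENNReal.ofReal ((Ioi (0 : ℝ)).indicator f ‖w‖) * ‖w‖ₑ ^ (-α)) := by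
    refine setLIntegral_mono' Metric.isClosed_closedBall.measurableSet fun w hw => ?_
    rcases eq_or_ne w 0 with rfl | hw0
    · simp
    · have hle : ‖w‖ₑ ^ α ≤ ENNReal.ofReal R ^ α := by
        rw [← ofReal_norm]
        exact ENNReal.rpow_le_rpow (ENNReal.ofReal_le_ofReal (mem_closedBall_zero_iff.1 hw)) hα0.le
      calc ENNReal.ofReal ((Ioi (0 : ℝ)).indicator f ‖w‖)
          = ‖w‖ₑ ^ α * (ENNReal.ofReal ((Ioi (0 : ℝ)).indicator f ‖w‖) * ‖w‖ₑ ^ (-α)) := by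
            rw [mul_left_comm, ← ENNReal.rpow_add _ _ (by simpa using hw0) (by simp)]
            simp
        _ ≤ _ := by gcongr
  refine h1.trans_lt ?_
  rw [lintegral_const_mul _ (by fun_prop)]
  exact ENNReal.mul_lt_top (ENNReal.rpow_lt_top_of_nonneg hα0.le ENNReal.ofReal_ne_top)
    (lintegral_closedBall_mul_norm_rpow_lt_top hf_cont hf_nonneg hfα R)

end RadialProfile

section Coordinates

/-- The spatial coordinates of a point of `ℝ³`. -/
noncomputable def spacePart (v : Fin 3 → ℝ) : Plane := WithLp.toLp 2 ![v 1, v 2]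

/-- The coordinates of a space-time point. -/
noncomputable def spaceTimeCoord (p : ℝ≥0 × Plane) : Fin 3 → ℝ := ![p.1, p.2 0, p.2 1]

lemma spacePart_spaceTimeCoord (p : ℝ≥0 × Plane) : spacePart (spaceTimeCoord p) = p.2 := by
  ext i
  fin_cases i <;> rfl

lemma norm_spacePart_sub_le (v w : Fin 3 → ℝ) : ‖spacePart v - spacePart w‖ ≤ 2 * ‖v - w‖ := by
  have h1 := norm_le_pi_norm (v - w) 1
  have h2 := norm_le_pi_norm (v - w) 2
  simp only [Pi.sub_apply, Real.norm_eq_abs] at h1 h2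
  have h0 := norm_nonneg (v - w)
  refine abs_le_of_sq_le_sq' ?_ (by positivity) |>.2
  rw [Plane.norm_sq]
  simp only [PiLp.sub_apply, spacePart, Matrix.cons_val_zero, Matrix.cons_val_one]
  nlinarith [sq_le_sq' (abs_le.1 h1).1 (abs_le.1 h1).2, sq_le_sq' (abs_le.1 h2).1 (abs_le.1 h2).2]

lemma norm_spacePart_le (v : Fin 3 → ℝ) : ‖spacePart v‖ ≤ 2 * ‖v‖ := by
  have h := norm_spacePart_sub_le v 0
  have h0 : spacePart 0 = 0 := by
    ext i
    fin_cases i <;> rfl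
  rwa [h0, sub_zero, sub_zero] at h

lemma norm_spaceTimeCoord_sub_le (p q : ℝ≥0 × Plane) :
    ‖spaceTimeCoord p - spaceTimeCoord q‖ ≤ dist p q := by
  refine (pi_norm_le_iff_of_nonneg dist_nonneg).2 fun i => ?_
  have h1 : dist p.1 q.1 ≤ dist p q := le_max_left _ _
  have h2 : dist p.2 q.2 ≤ dist p q := le_max_right _ _
  rw [dist_eq_norm] at h2
  fin_cases i
  · exact h1
  · exact (PiLp.norm_apply_le (p.2 - q.2) 0).trans h2
  · exact (PiLp.norm_apply_le (p.2 - q.2) 1).trans h2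

end Coordinates

section MildSolution

variable {Ω : Type*} [MeasurableSpace Ω] {P : Measure Ω} {f : ℝ → ℝ} {F : TestFn → Ω → ℝ}
  {m α : ℝ}

lemma IsNoiseKernel.exists_isMildSolution (hf : IsNoiseKernel f)
    (hF : IsSpatialGaussianNoise P f F) (hm0 : 0 ≤ m) (hm1 : m < 1) (hα0 : 0 < α) (hα1 : α < 1)
    (hsing : ∀ R : ℝ, ∫⁻ w in Metric.closedBall (0 : Plane) R,
      ENNReal.ofReal (f ‖w‖) * ‖w‖ₑ ^ (-α) < ∞) :
    ∃ X, IsMildSolution P m f F X := by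
  have h : ∀ t x, ∃ Y, IsStochIntegral P f F (greenIntegrand m t x) Y := by
    intro t x
    refine hF.exists_isStochIntegral hf (measurable_greenIntegrand hm0 hm1 t x)
      (norm_le_of_greenIntegrand_ne_zero hm0 hm1 t x) ?_
    obtain ⟨C, hC, hCb⟩ := exists_walshForm_greenIntegrand_sub_le hf (hF.isPositiveOnTestFn hf)
      hm0 hm1 (θ := α / 8) hα1 (by linarith) (by linarith) hsing (max t ‖x‖)
    have h0 : ∀ p, greenIntegrand m 0 x p = 0 := fun p => by simp [greenIntegrand]
    have := hCb t 0 x x (le_max_left _ _) ((NNReal.coe_nonneg t).trans (le_max_left _ _))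
      (le_max_right _ _) (le_max_right _ _)
    simp only [h0, sub_zero] at this
    exact ne_top_of_le_ne_top (ENNReal.mul_ne_top hC (ENNReal.pow_ne_top
      (ENNReal.rpow_ne_top_of_nonneg (by linarith) ENNReal.ofReal_ne_top))) this
  choose X hX using h
  exact ⟨X, hX⟩

lemma IsMildSolution.exists_eLpNorm_sub_le {X : ℝ≥0 → Plane → Ω → ℝ}
    (hX : IsMildSolution P m f F X) (hf : IsNoiseKernel f)
    (hF : IsSpatialGaussianNoise P f F) (hm0 : 0 ≤ m) (hm1 : m < 1) (hα1 : α < 1)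
    (hsing : ∀ R : ℝ, ∫⁻ w in Metric.closedBall (0 : Plane) R,
      ENNReal.ofReal (f ‖w‖) * ‖w‖ₑ ^ (-α) < ∞) {θ : ℝ} (hθ0 : 0 < θ) (hθ : θ < α / 4) (T : ℝ)
    {p : ℝ≥0∞} (hp : p ≠ ∞) :
    ∃ C : ℝ≥0∞, C ≠ ∞ ∧ ∀ (t t' : ℝ≥0) (x x' : Plane), (t : ℝ) ≤ T → (t' : ℝ) ≤ T →
      ‖x‖ ≤ T → ‖x'‖ ≤ T → eLpNorm (fun ω => X t x ω - X t' x' ω) p P ≤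
        C * ENNReal.ofReal (|(t : ℝ) - t'| + ‖x - x'‖) ^ θ := by
  obtain ⟨C, hC, hCb⟩ := exists_walshForm_greenIntegrand_sub_le hf (hF.isPositiveOnTestFn hf)
    hm0 hm1 hα1 hθ0 hθ hsing T
  refine ⟨gaussianMoment p * (2 * C) ^ (1 / 2 : ℝ), ENNReal.mul_ne_top (gaussianMoment_ne_top hp)
    (ENNReal.rpow_ne_top_of_nonneg (by norm_num) (ENNReal.mul_ne_top (by simp) hC)), ?_⟩
  intro t t' x x' ht ht' hx hx'
  refine (hF.eLpNorm_integral_sub_le hf (hX t x) (hX t' x') hp).trans ?_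
  rw [mul_assoc]
  gcongr
  refine (ENNReal.rpow_le_rpow (mul_le_mul_right (hCb t t' x x' ht ht' hx hx') 2)
    (by norm_num)).trans (le_of_eq ?_)
  rw [← mul_assoc, ENNReal.mul_rpow_of_nonneg _ _ (by norm_num : (0 : ℝ) ≤ 1 / 2)]
  congr 1
  rw [← ENNReal.rpow_natCast, ← ENNReal.rpow_mul]
  norm_num

lemma IsMildSolution.exists_holder_modification [IsProbabilityMeasure P]
    {X : ℝ≥0 → Plane → Ω → ℝ}
    (hX : IsMildSolution P m f F X) (hf : IsNoiseKernel f)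
    (hF : IsSpatialGaussianNoise P f F) (hm0 : 0 ≤ m) (hm1 : m < 1) (hα0 : 0 < α) (hα1 : α < 1)
    (hsing : ∀ R : ℝ, ∫⁻ w in Metric.closedBall (0 : Plane) R,
      ENNReal.ofReal (f ‖w‖) * ‖w‖ₑ ^ (-α) < ∞) :
    ∃ X' : ℝ≥0 → Plane → Ω → ℝ,
      (∀ t x, Measurable (X' t x)) ∧
      (∀ t x, X' t x =ᵐ[P] X t x) ∧
      ∀ ω, ∀ b : ℝ≥0, 0 < b → (b : ℝ) < α / 4 →
        ∀ K : Set (ℝ≥0 × Plane), IsCompact K →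
          ∃ C : ℝ≥0, HolderOnWith C b (fun p => X' p.1 p.2 ω) K := by
  have hmeas : ∀ t x, AEStronglyMeasurable (X t x) P := fun t x => (hX t x).memLp.1
  let Z : (Fin 3 → ℝ) → Ω → ℝ := fun v => (hmeas (v 0).toNNReal (spacePart v)).mk
  have hZX : ∀ v, Z v =ᵐ[P] X (v 0).toNNReal (spacePart v) := fun v =>
    (hmeas _ _).ae_eq_mk.symm
  have hZm : ∀ v, Measurable (Z v) := fun v => (hmeas _ _).stronglyMeasurable_mk.measurable
  obtain ⟨Z', hZ'm, hZ'Z, hZ'h⟩ := _root_.exists_holder_modification (P := P) hZm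
    (γ := α / 4) (by linarith) (by
      intro R θ hθ0 hθ p hp
      obtain ⟨C, hC, hCb⟩ := hX.exists_eLpNorm_sub_le hf hF hm0 hm1 hα1 hsing hθ0 hθ (2 * R)
        (p := p) (by simp)
      refine ⟨C * ENNReal.ofReal ((3 : ℝ) ^ θ), ENNReal.mul_ne_top hC (by simp), ?_⟩
      intro v w hv hw
      have ht : ∀ v : Fin 3 → ℝ, ‖v‖ ≤ R → (((v 0).toNNReal : ℝ≥0) : ℝ) ≤ 2 * R := by
        intro v hv
        have h1 := (norm_le_pi_norm v 0).trans hv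
        rw [Real.coe_toNNReal']
        refine max_le ?_ (by positivity)
        linarith [le_abs_self (v 0), Real.norm_eq_abs (v 0), (R.cast_nonneg : (0 : ℝ) ≤ R)]
      have hx : ∀ v : Fin 3 → ℝ, ‖v‖ ≤ R → ‖spacePart v‖ ≤ 2 * R := fun v hv =>
        (norm_spacePart_le v).trans (by linarith)
      have h1 : eLpNorm (fun ω => Z v ω - Z w ω) p P =
          eLpNorm (fun ω => X (v 0).toNNReal (spacePart v) ω -
            X (w 0).toNNReal (spacePart w) ω) p P := by
        refine eLpNorm_congr_ae ?_
        filter_upwards [hZX v, hZX w] with ω h1 h2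
        rw [h1, h2]
      rw [h1]
      refine (hCb _ _ _ _ (ht v hv) (ht w hw) (hx v hv) (hx w hw)).trans ?_
      rw [mul_assoc, ← ENNReal.ofReal_mul (by positivity), ← Real.mul_rpow (by norm_num)
        (norm_nonneg _), ← ENNReal.ofReal_rpow_of_nonneg (by positivity) hθ0.le]
      gcongr
      have h2 := norm_spacePart_sub_le v w
      have h3 := norm_le_pi_norm (v - w) 0
      rw [Real.coe_toNNReal', Real.coe_toNNReal']
      have h4 := abs_max_sub_max_le_abs (v 0) (w 0) 0
      rw [Pi.sub_apply, Real.norm_eq_abs] at h3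
      linarith)
  refine ⟨fun t x => Z' (spaceTimeCoord (t, x)), fun t x => hZ'm _, fun t x => ?_, ?_⟩
  · filter_upwards [hZ'Z (spaceTimeCoord (t, x)), hZX (spaceTimeCoord (t, x))] with ω h1 h2
    rw [h1, h2, spacePart_spaceTimeCoord]
    simp [spaceTimeCoord]
  · intro ω b hb0 hb K hK
    have hlip : LipschitzWith 1 spaceTimeCoord := LipschitzWith.mk_one fun p q => by
      rw [dist_eq_norm]
      exact norm_spaceTimeCoord_sub_le p q
    obtain ⟨R₀, hR₀⟩ := (hK.image hlip.continuous).isBounded.exists_norm_le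
    obtain ⟨R, hR⟩ := exists_nat_ge R₀
    obtain ⟨C, hC0, hC⟩ := hZ'h ω b (by exact_mod_cast hb0) hb R
    refine ⟨C.toNNReal, fun p hp q hq => ?_⟩
    have h1 := hC (spaceTimeCoord p) (spaceTimeCoord q)
      ((hR₀ _ (mem_image_of_mem _ hp)).trans hR) ((hR₀ _ (mem_image_of_mem _ hq)).trans hR)
    rw [edist_dist, edist_dist, ENNReal.ofReal_rpow_of_nonneg dist_nonneg b.coe_nonneg,
      ← ENNReal.ofReal_coe_nnreal, Real.coe_toNNReal _ hC0, ← ENNReal.ofReal_mul hC0]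
    refine ENNReal.ofReal_le_ofReal ?_
    rw [Real.dist_eq]
    refine h1.trans (mul_le_mul_of_nonneg_left ?_ hC0)
    exact Real.rpow_le_rpow (norm_nonneg _) (norm_spaceTimeCoord_sub_le p q) b.coe_nonneg

end MildSolution

theorem theorem2 {Ω : Type*} [MeasurableSpace Ω] (P : Measure Ω) [IsProbabilityMeasure P]
    (m : ℝ) (hm0 : 0 ≤ m) (hm1 : m < 1)
    (f : ℝ → ℝ) (hf_cont : ContinuousOn f (Ioi 0)) (hf_nonneg : ∀ r, 0 < r → 0 ≤ f r)
    (F : TestFn → Ω → ℝ) (hF : IsSpatialGaussianNoise P f F)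
    (α : ℝ) (hα0 : 0 < α) (hα1 : α < 1)
    (hfα : IntegrableAtFilter (fun r : ℝ => f r * r ^ (1 - α)) (𝓝[>] 0) volume) :
    (∃ X : ℝ≥0 → Plane → Ω → ℝ, IsMildSolution P m f F X) ∧
    ∀ X : ℝ≥0 → Plane → Ω → ℝ, IsMildSolution P m f F X →
      ∃ X' : ℝ≥0 → Plane → Ω → ℝ,
        (∀ t x, Measurable (X' t x)) ∧
        (∀ t x, X' t x =ᵐ[P] X t x) ∧
        ∀ ω, ∀ b : ℝ≥0, 0 < b → (b : ℝ) < α / 4 →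
          ∀ K : Set (ℝ≥0 × Plane), IsCompact K →
            ∃ C : ℝ≥0, HolderOnWith C b (fun p => X' p.1 p.2 ω) K := by
  have hk := isNoiseKernel_indicator hf_cont hf_nonneg hα0 hfα
  have hsing := lintegral_closedBall_mul_norm_rpow_lt_top hf_cont hf_nonneg hfα
  refine ⟨?_, fun X hX => ?_⟩
  · obtain ⟨X, hX⟩ := hk.exists_isMildSolution hF.indicator hm0 hm1 hα0 hα1 hsing
    exact ⟨X, fun t x => isStochIntegral_indicator_iff.1 (hX t x)⟩
  · have hX' : IsMildSolution P m ((Ioi (0 : ℝ)).indicator f) F X := fun t x =>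
      isStochIntegral_indicator_iff.2 (hX t x)
    exact hX'.exists_holder_modification hk hF.indicator hm0 hm1 hα0 hα1 hsing
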